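/- Let $\eta$ be the Dedekind eta function, $\mathbb H$ the upper half plane, and put $$y(\tau)=9\,\frac{\eta(\tau)^4\eta(6\tau)^8}{\eta(3\tau)^4\eta(2\tau)^8},\qquad b_0(\tau)=\frac{2\sqrt3}{3}\,\frac{\eta(2\tau)^6\eta(3\tau)}{\eta(\tau)^3\eta(6\tau)^2},$$ $$g_6=\frac{y(y-1)(y-9)(y^2-2y+9)(y^2-18y+9)^3}{864\,(y-3)^3(y+3)^3}\,b_0^6,\qquad g_4=\frac{(y^2-18y+9)^2(y^4-12y^3+102y^2-108y+81)}{288\,(y-3)^2(y+3)^2}\,b_0^4 .$$ Let $X=\{\tau\in\mathbb H: y(\tau)\neq\pm3\}$. All paths below are piecewise $C^1$ paths in $X$; a path starts at the cusp $i\infty$ if its imaginary part tends to $+\infty$ at its start while its real part stays bounded there, and it ends at the cusp $\gamma(i\infty)$, $\gamma\in SL_2(\mathbb Z)$, if its image under $\gamma^{-1}$ tends to $i\infty$ in the same sense. Homotopies are in $X$, with fixed end points, and approach a cusp in this sense, uniformly. For a path $p$ from $i\infty$ to $\tau\in X$ let $$I(f_1,\dots,f_n;\tau)=(2\pi i)^n\int_{i\infty}^{\tau}d\tau_1\,f_1(\tau_1)\int_{i\infty}^{\tau_1}d\tau_2\,f_2(\tau_2)\cdots\int_{i\infty}^{\tau_{n-1}}d\tau_n\,f_n(\tau_n)$$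 be the iterated integral along $p$ (a limit over starting points on $p$ tending to $i\infty$), with the same notation for a path from $i\infty$ to another cusp; $\{1\}^j$ denotes $j$ letters $1$. Define, as functions of $\tau$ and of the path $p$, $$f_{2,b}=I(1,g_6;\tau),\qquad f_{4,b}=g_4-\tfrac32 f_{2,b}^2,\qquad f_6=4g_6-2g_4f_{2,b}+f_{2,b}^3 .$$ A function $F$ of $\tau$ and the homotopy class of a path from $i\infty$ to $\tau$ is quasi-Eichler of weight $k$ and depth $n$ for $\Gamma\subset SL_2(\mathbb Z)$ if there are functions $f_1,\dots,f_n$ of the same kind, independent of $\gamma$, such that for every $\gamma=\begin{pmatrix}a&b\\c&d\end{pmatrix}\in\Gamma$ and every path $r$ from $i\infty$ to $\gamma(i\infty)$ there is a polynomial $P_\gamma$ of degree at most $n-k$ with $$(c\tau+d)^{-k}F(\gamma(\tau))=F(\tau)+\sum_{j=1}^n\Big(\frac{c}{c\tau+d}\Big)^jf_j(\tau)+\frac{P_\gamma(\tau)}{(c\tau+d)^n}$$ for all $\tau\in X$, where $F(\tau)$ is taken along a path $p$ from $i\infty$ to $\tau$ and $F(\gamma(\tau))$ along a path $p'$ from $i\infty$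 to $\gamma(\tau)$ such that the closed path "$r$, then $\gamma\circ p$, then $p'$ reversed" is homotopically trivial. Then the following hold. (0) The integrals $I(\{1\}^j,g_6;\tau)$, $j\ge0$, converge along every path from $i\infty$ to $\tau\in X$. For $\gamma\in\Gamma_1(6)$ with $c\ne0$ and every path $r$ from $i\infty$ to $a/c=\gamma(i\infty)$, the integrals $C_6=I(g_6;i\infty,a/c)$ and $C_{1,6}=I(1,g_6;i\infty,a/c)$ along $r$ converge. (1) Let $\gamma\in\Gamma_1(6)$, $c\neq0$, let $r$ be a path from $i\infty$ to $a/c$, and let $p$, $p'$ be paths from $i\infty$ to $\tau$ and to $\gamma(\tau)$ such that the closed path "$r$, then $\gamma\circ p$, then $p'$ reversed" is homotopically trivial. Then, with values at $\gamma(\tau)$ taken along $p'$ and values at $\tau$ along $p$, $$(c\tau+d)^{-2}f_{2,b}(\gamma(\tau))=f_{2,b}(\tau)+\Delta,$$ $$\Delta=-\frac{6}{2\pi i}\frac{c}{c\tau+d}I(\{1\}^2,g_6;\tau)+\frac{18}{(2\pi i)^2}\Big(\frac{c}{c\tau+d}\Big)^2I(\{1\}^3,g_6;\tau)-\frac{24}{(2\pi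 i)^3}\Big(\frac{c}{c\tau+d}\Big)^3I(\{1\}^4,g_6;\tau)+\frac{C_{1,6}}{(c\tau+d)^2}-\frac{2\pi i\,C_6}{c(c\tau+d)^3},$$ and consequently $$(c\tau+d)^{-4}f_{4,b}(\gamma(\tau))=f_{4,b}-3f_{2,b}\Delta-\tfrac32\Delta^2,\qquad (c\tau+d)^{-6}f_6(\gamma(\tau))=f_6-2f_{4,b}\Delta+3f_{2,b}\Delta^2+\Delta^3,$$ the right-hand sides being taken at $\tau$. (2) If $\gamma\in\Gamma_1(6)$ has $c=0$ and $p'$ is homotopic to $\gamma\circ p$, then $f_{2,b}$, $f_{4,b}$ and $f_6$ take the same values at $\gamma(\tau)$ along $p'$ as at $\tau$ along $p$. (3) $f_{2,b}$ is quasi-Eichler of weight $2$ and depth $3$ for $\Gamma_1(6)$. -/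

import Mathlib

open scoped UpperHalfPlane MatrixGroups Topology
open Filter Set

noncomputable section

namespace Banana

/-- The Hauptmodul `y = 9 η(τ)⁴ η(6τ)⁸ / (η(3τ)⁴ η(2τ)⁸)` of `Γ₁(6)`. -/
def y (τ : ℍ) : ℂ :=
  9 * (ModularForm.eta τ ^ 4 * ModularForm.eta (6 * τ) ^ 8) /
    (ModularForm.eta (3 * τ) ^ 4 * ModularForm.eta (2 * τ) ^ 8)

/-- The weight one form `b₀ = ψ₁ / π` (`ψ₁` the sunrise period),
`b₀ = (2 √3 / 3) η(2τ)⁶ η(3τ) / (η(τ)³ η(6τ)²)`. -/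
def b0 (τ : ℍ) : ℂ :=
  (2 / 3 : ℂ) * (Real.sqrt 3 : ℂ) *
    (ModularForm.eta (2 * τ) ^ 6 * ModularForm.eta (3 * τ)) /
    (ModularForm.eta τ ^ 3 * ModularForm.eta (6 * τ) ^ 2)

/-- The meromorphic modular form `g₆` of weight six. It has poles exactly where `y = ±3`. -/
def g6 (τ : ℍ) : ℂ :=
  y τ * (y τ - 1) * (y τ - 9) * (y τ ^ 2 - 2 * y τ + 9) * (y τ ^ 2 - 18 * y τ + 9) ^ 3 /
    (864 * (y τ - 3) ^ 3 * (y τ + 3) ^ 3) * b0 τ ^ 6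

/-- The meromorphic modular form of weight four that occurs in `f_{4,b}` and `f₆`. -/
def g4 (τ : ℍ) : ℂ :=
  (y τ ^ 2 - 18 * y τ + 9) ^ 2 *
      (y τ ^ 4 - 12 * y τ ^ 3 + 102 * y τ ^ 2 - 108 * y τ + 81) /
    (288 * (y τ - 3) ^ 2 * (y τ + 3) ^ 2) * b0 τ ^ 4

/-- The points of the upper half plane that integration paths have to avoid. -/
def poles : Set ℍ := {τ | y τ = 3 ∨ y τ = -3}

/-- `u` tends to the cusp `i∞` along `l`, inside a vertical strip. -/
def TendsToInfty {α : Type} (u : α → ℍ) (l : Filter α) : Prop :=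
  Tendsto (fun x => (u x).im) l atTop ∧ ∃ B : ℝ, ∀ᶠ x in l, |(u x).re| ≤ B

/-- The velocity of a path in the upper half plane. -/
def velocity (p : ℝ → ℍ) (t : ℝ) : ℂ := deriv (fun u : ℝ => ((p u : ℍ) : ℂ)) t

/-- `p` is continuous on the interval `J`, continuously differentiable in the interior of `J`
outside a finite set of parameters, with velocity bounded on compact parts of `J`. -/
def PiecewiseC1On (p : ℝ → ℍ) (J : Set ℝ) : Prop :=
  ContinuousOn p J ∧
  (∃ S : Set ℝ, S.Finite ∧
    ∀ t ∈ interior J \ S, ContDiffAt ℝ 1 (fun u : ℝ => ((p u : ℍ) : ℂ)) t) ∧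
  ∀ K ⊆ J, IsCompact K → ∃ M : ℝ, ∀ t ∈ K, ‖velocity p t‖ ≤ M

/-- `p`, restricted to `(0, 1]`, is a path from the cusp `i∞` to `τ` that avoids the poles. -/
structure IsPathFromInfty (p : ℝ → ℍ) (τ : ℍ) : Prop where
  piecewise : PiecewiseC1On p (Ioc 0 1)
  avoids : ∀ t ∈ Ioc (0 : ℝ) 1, p t ∉ poles
  source : TendsToInfty p (𝓝[>] 0)
  target : p 1 = τ

/-- `r`, restricted to `(0, 1)`, is a path from the cusp `i∞` to the cusp `γ(i∞)`
(which is `a / c` if `c ≠ 0`) that avoids the poles. -/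
structure IsPathToCusp (γ : SL(2, ℤ)) (r : ℝ → ℍ) : Prop where
  piecewise : PiecewiseC1On r (Ioo 0 1)
  avoids : ∀ t ∈ Ioo (0 : ℝ) 1, r t ∉ poles
  source : TendsToInfty r (𝓝[>] 0)
  target : TendsToInfty (fun t => γ⁻¹ • r t) (𝓝[<] 1)

/-- Homotopy, in the complement of the poles and with fixed end points, of two paths from
the cusp `i∞` to the same point. -/
def Homotopic (p₀ p₁ : ℝ → ℍ) : Prop :=
  ∃ H : ℝ × ℝ → ℍ,
    ContinuousOn H (Icc 0 1 ×ˢ Ioc 0 1) ∧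
    (∀ x ∈ Icc (0 : ℝ) 1 ×ˢ Ioc (0 : ℝ) 1, H x ∉ poles) ∧
    TendsToInfty H (𝓟 (Icc 0 1) ×ˢ 𝓝[>] 0) ∧
    (∀ t ∈ Ioc (0 : ℝ) 1, H (0, t) = p₀ t) ∧
    (∀ t ∈ Ioc (0 : ℝ) 1, H (1, t) = p₁ t) ∧
    (∀ s ∈ Icc (0 : ℝ) 1, H (s, 1) = p₀ 1)

/-- The unit square without its lower edge `t = 0` (which represents the cusp `i∞`) and
without the point `(1, 1/2)` (which represents the cusp `γ(i∞)`). -/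
def puncturedSquare : Set (ℝ × ℝ) := (Icc 0 1 ×ˢ Ioc 0 1) \ {(1, 1 / 2)}

/-- The closed path consisting of `r` (from `i∞` to `γ(i∞)`), followed by `γ ∘ p`
(from `γ(i∞)` to `γ(τ)`), followed by the reverse of `p'` (from `γ(τ)` to `i∞`) is
homotopically trivial in the complement of the poles: `p'` is homotopic with fixed end points
to the concatenation of `r` and `γ ∘ p`, which passes through the cusp `γ(i∞)` at time `1/2`. -/
def TrivialLoop (γ : SL(2, ℤ)) (r p p' : ℝ → ℍ) : Prop :=
  ∃ H : ℝ × ℝ → ℍ,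
    ContinuousOn H puncturedSquare ∧
    (∀ x ∈ puncturedSquare, H x ∉ poles) ∧
    TendsToInfty H (𝓟 (Icc 0 1) ×ˢ 𝓝[>] 0) ∧
    TendsToInfty (fun x => γ⁻¹ • H x) (𝓝[puncturedSquare] (1, 1 / 2)) ∧
    (∀ t ∈ Ioc (0 : ℝ) 1, H (0, t) = p' t) ∧
    (∀ t ∈ Ioo (0 : ℝ) (1 / 2), H (1, t) = r (2 * t)) ∧
    (∀ t ∈ Ioc (1 / 2 : ℝ) 1, H (1, t) = γ • p (2 * t - 1)) ∧
    (∀ s ∈ Icc (0 : ℝ) 1, H (s, 1) = p' 1)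

/-- The iterated integral `I(f₁, …, fₙ)` along the part of `p` between the parameters
`t₀` and `t`; the first letter is the outermost one, each integration carries a `2πi`. -/
def iterInt (p : ℝ → ℍ) (t₀ : ℝ) : List (ℍ → ℂ) → ℝ → ℂ
  | [], _ => 1
  | f :: fs, t =>
      2 * Real.pi * Complex.I * ∫ s in t₀..t, f (p s) * velocity p s * iterInt p t₀ fs s

/-- The iterated integral along a path from `i∞`, as a limit over the starting point. (For a
last letter vanishing at `i∞` no further regularisation is needed.) -/
def cuspInt (p : ℝ → ℍ) (fs : List (ℍ → ℂ)) : ℂ :=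
  limUnder (𝓝[>] (0 : ℝ)) fun t₀ => iterInt p t₀ fs 1

/-- The limit defining `cuspInt` exists. -/
def CuspIntConverges (p : ℝ → ℍ) (fs : List (ℍ → ℂ)) : Prop :=
  Tendsto (fun t₀ => iterInt p t₀ fs 1) (𝓝[>] (0 : ℝ)) (𝓝 (cuspInt p fs))

/-- The iterated integral along a path from the cusp `i∞` to another cusp. -/
def cuspCuspInt (r : ℝ → ℍ) (fs : List (ℍ → ℂ)) : ℂ :=
  limUnder (𝓝[>] (0 : ℝ) ×ˢ 𝓝[<] (1 : ℝ)) fun t => iterInt r t.1 fs t.2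

/-- The limit defining `cuspCuspInt` exists. -/
def CuspCuspIntConverges (r : ℝ → ℍ) (fs : List (ℍ → ℂ)) : Prop :=
  Tendsto (fun t : ℝ × ℝ => iterInt r t.1 fs t.2) (𝓝[>] (0 : ℝ) ×ˢ 𝓝[<] (1 : ℝ))
    (𝓝 (cuspCuspInt r fs))

/-- The word `{1}^j, g₆`. -/
def word (j : ℕ) : List (ℍ → ℂ) := List.replicate j (fun _ => 1) ++ [g6]

/-- `f_{2,b} = I(1, g₆; τ)`, as a function of the path from `i∞` to `τ`. -/
def f2b (p : ℝ → ℍ) : ℂ := cuspInt p (word 1)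

/-- `f_{4,b}`, as a function of the path from `i∞` to `τ = p 1`. -/
def f4b (p : ℝ → ℍ) : ℂ := g4 (p 1) - 3 / 2 * f2b p ^ 2

/-- `f₆`, as a function of the path from `i∞` to `τ = p 1`. -/
def f6 (p : ℝ → ℍ) : ℂ := 4 * g6 (p 1) - 2 * g4 (p 1) * f2b p + f2b p ^ 3

/-- The automorphic factor `cτ + d`. -/
def autFactor (γ : SL(2, ℤ)) (τ : ℍ) : ℂ := ((γ 1 0 : ℤ) : ℂ) * τ + ((γ 1 1 : ℤ) : ℂ)

/-- A function of paths from `i∞` is a multivalued function on the complement of the poles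
if it depends on the homotopy class only. -/
def IsMultivalued (F : (ℝ → ℍ) → ℂ) : Prop :=
  ∀ (τ : ℍ) (p₀ p₁ : ℝ → ℍ), IsPathFromInfty p₀ τ → IsPathFromInfty p₁ τ →
    Homotopic p₀ p₁ → F p₀ = F p₁

/-- `F` transforms under `Γ` as quasi-Eichler of modular weight `k` and depth `n`. The functions
`f j` do not depend on `γ`; the polynomial `P`, of degree at most `n - k`, depends on `γ` and
on the path `r` from `i∞` to `γ(i∞)` (up to which `γ` acts on multivalued functions), but not
on `τ`. -/
def IsQuasiEichler (Γ : Subgroup SL(2, ℤ)) (F : (ℝ → ℍ) → ℂ) (k : ℤ) (n : ℕ) : Prop :=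
  IsMultivalued F ∧
  ∃ f : ℕ → (ℝ → ℍ) → ℂ, (∀ j, IsMultivalued (f j)) ∧
    ∀ γ ∈ Γ, ∀ r : ℝ → ℍ, IsPathToCusp γ r →
      ∃ P : Polynomial ℂ, (∀ i : ℕ, (n : ℤ) - k < i → P.coeff i = 0) ∧
        ∀ (τ : ℍ) (p p' : ℝ → ℍ), IsPathFromInfty p τ → IsPathFromInfty p' (γ • τ) →
          TrivialLoop γ r p p' →
          autFactor γ τ ^ (-k) * F p' =
            F p + ∑ j ∈ Finset.Icc 1 n, (((γ 1 0 : ℤ) : ℂ) / autFactor γ τ) ^ j * f j p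
              + P.eval (τ : ℂ) / autFactor γ τ ^ n

/-- The correction term in the transformation law of `f_{2,b}`. -/
def correction (γ : SL(2, ℤ)) (r p : ℝ → ℍ) (τ : ℍ) : ℂ :=
  let c : ℂ := ((γ 1 0 : ℤ) : ℂ);
  let J : ℂ := autFactor γ τ;
  let w : ℂ := 2 * Real.pi * Complex.I;
  -6 * (c / J) * (1 / w) * cuspInt p (word 2)
    + 18 * (c / J) ^ 2 * (1 / w ^ 2) * cuspInt p (word 3)
    - 24 * (c / J) ^ 3 * (1 / w ^ 3) * cuspInt p (word 4)
    + cuspCuspInt r (word 1) / J ^ 2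
    - w * cuspCuspInt r (word 0) / (c * J ^ 3)

end Banana

end

noncomputable section

namespace Banana

/-! By Cauchy's formula for repeated integration, the iterated integral of the word `{1}^n, g₆` up
to `τ` is a single integral of `g₆(z)` against `(2πi)^(n+1) (τ - z)^n / n!`
(`PiecewiseC1On.iterInt_word`). Everything therefore concerns the closed forms `P(z) g₆(z) dz` with
`P` a polynomial.

Since `g₆` has weight six under `Γ₁(6)`, the substitution `z = γu` turns `P g₆ dz` into `Q g₆ du`
with `Q(u) = (cu + d)^4 P(γu)` (`IsSlash`). Splitting `p'` into `r` and `γ ∘ p`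
(`TrivialLoop.cuspLineInt_eq`) writes `f2b p'` as an integral over `r` of the kernel `γτ - z` plus
an integral over `p` of the transformed kernel. With `J_u = cu + d`, the identities `γτ - γu = (τ -
u) / (J_τ J_u)` and `J_u = J_τ - c(τ - u)` make the transformed kernel a combination of `(τ - u)^k`,
`1 ≤ k ≤ 4`, that is, of the words with up to four letters `1` (`isSlash_kernelPoly_one`). The
integral over `r` is affine in `γτ`; its two coefficients give the constants `C_{1,6}` and `C_6`, or
the polynomial of degree one. The laws for `f4b` and `f6` follow by algebra.

Two inputs carry this. The weights come from the multiplier system of `η²`. Convergence comes from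
`g₆` being a power series in `q` without constant term, so that `P g₆` has a primitive tending to
zero in vertical strips. Homotopies are merely continuous, so Cauchy's theorem is proved with
primitives along curves (`IsPrimitiveAlong.rectangle`). -/

/-! ### The multiplier system of `η²` on `SL(2, ℤ)`. -/

/-- The exponent (modulo 12) of the multiplier of `η²`. -/
def etaExp {R : Type} [CommRing R] (a b c d : R) : R :=
  (1 - c ^ 2) * (b * d + 3 * (c - 1) * d + c + 3) + c * (a + d - 3)

/-- The multiplier of `η²` attached to an exponent modulo `12`. -/
def zeta12 (k : ℤ) : ℂ := Complex.exp (2 * Real.pi * Complex.I / 12) ^ k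

lemma zeta12_add (k l : ℤ) : zeta12 (k + l) = zeta12 k * zeta12 l :=
  zpow_add₀ (Complex.exp_ne_zero _) k l

lemma zeta12_mul (k l : ℤ) : zeta12 (k * l) = zeta12 k ^ l := zpow_mul _ k l

lemma zeta12_ne_zero (k : ℤ) : zeta12 k ≠ 0 := zpow_ne_zero _ (Complex.exp_ne_zero _)

lemma zeta12_eq_one_of_dvd {k : ℤ} (h : 12 ∣ k) : zeta12 k = 1 := by
  obtain ⟨m, rfl⟩ := h
  have h1 : Complex.exp (2 * Real.pi * Complex.I / 12) ^ (12 : ℤ) = 1 := by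
    rw [← Complex.exp_int_mul, ← Complex.exp_two_pi_mul_I]
    congr 1
    push_cast
    ring
  rw [zeta12_mul, zeta12, h1, one_zpow]

lemma zeta12_congr {k l : ℤ} (h : 12 ∣ k - l) : zeta12 k = zeta12 l := by
  rw [← sub_add_cancel k l, zeta12_add, zeta12_eq_one_of_dvd h, one_mul]

lemma zeta12_neg_three : zeta12 (-3) = Complex.I⁻¹ := by
  have : zeta12 3 = Complex.I := by
    rw [zeta12, ← Complex.exp_int_mul]
    refine Eq.trans ?_ Complex.exp_pi_div_two_mul_I
    congr 1
    push_cast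
    ring
  rw [show (-3 : ℤ) = 3 * (-1) by norm_num, zeta12_mul, this, zpow_neg_one]

lemma int_dvd_of_mod_three_four {k : ℤ} (h3 : ((k : ℤ) : ZMod 3) = 0) (h4 : ((k : ℤ) : ZMod 4) = 0) :
    12 ∣ k := by
  rw [ZMod.intCast_zmod_eq_zero_iff_dvd] at h3 h4
  omega

/-- `etaExp` is one polynomial expression over any commutative ring, without a case split on the
parity of `c`. Its behaviour modulo 12 under the generators is thus a finite check modulo 3 and
modulo 4. -/
lemma etaExp_T_mod_three : ∀ a b c d : ZMod 3, a * d - b * c = 1 →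
    etaExp (a + c) (b + d) c d - etaExp a b c d - 1 = 0 := by
  unfold etaExp; decide

lemma etaExp_T_mod_four : ∀ a b c d : ZMod 4, a * d - b * c = 1 →
    etaExp (a + c) (b + d) c d - etaExp a b c d - 1 = 0 := by
  unfold etaExp; decide

lemma etaExp_S_mod_three : ∀ a b c d : ZMod 3, a * d - b * c = 1 →
    etaExp (-c) (-d) a b - etaExp a b c d + 3 = 0 := by
  unfold etaExp; decide

lemma etaExp_S_mod_four : ∀ a b c d : ZMod 4, a * d - b * c = 1 →
    etaExp (-c) (-d) a b - etaExp a b c d + 3 = 0 := by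
  unfold etaExp; decide

lemma etaExp_cast {n : ℕ} (a b c d : ℤ) :
    ((etaExp a b c d : ℤ) : ZMod n) = etaExp (a : ZMod n) b c d := by
  simp [etaExp]

lemma etaExp_T {a b c d : ℤ} (h : a * d - b * c = 1) :
    12 ∣ etaExp (a + c) (b + d) c d - (etaExp a b c d + 1) := by
  rw [← sub_sub]
  apply int_dvd_of_mod_three_four
  · have := congrArg (Int.cast : ℤ → ZMod 3) h
    push_cast at this
    simpa [etaExp_cast] using etaExp_T_mod_three _ _ _ _ this
  · have := congrArg (Int.cast : ℤ → ZMod 4) h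
    push_cast at this
    simpa [etaExp_cast] using etaExp_T_mod_four _ _ _ _ this

lemma etaExp_S {a b c d : ℤ} (h : a * d - b * c = 1) :
    12 ∣ etaExp (-c) (-d) a b - (etaExp a b c d - 3) := by
  rw [← sub_add]
  apply int_dvd_of_mod_three_four
  · have := congrArg (Int.cast : ℤ → ZMod 3) h
    push_cast at this
    have := etaExp_S_mod_three _ _ _ _ this
    push_cast [etaExp_cast]
    exact this
  · have := congrArg (Int.cast : ℤ → ZMod 4) h
    push_cast at this
    have := etaExp_S_mod_four _ _ _ _ this
    push_cast [etaExp_cast]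
    exact this

lemma eta_add_one_sq (z : ℂ) : ModularForm.eta (z + 1) ^ 2 = zeta12 1 * ModularForm.eta z ^ 2 := by
  have h : ∀ n, ModularForm.eta_q n (z + 1) = ModularForm.eta_q n z := by
    intro n
    have : Function.Periodic.qParam 1 (z + 1) = Function.Periodic.qParam 1 z := by
      simp [Function.Periodic.qParam, mul_add, Complex.exp_add]
    simp only [ModularForm.eta_q, this]
  simp only [ModularForm.eta, h, zeta12, zpow_one, mul_pow, Function.Periodic.qParam,
    ← Complex.exp_nat_mul]
  rw [← mul_assoc, ← Complex.exp_add]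
  congr 3
  push_cast
  ring

/-- Squaring removes the choice of branch in the inversion formula of `η`; this is why `η²` is used
throughout. -/
lemma eta_neg_inv_sq {z : ℂ} (hz : 0 < z.im) :
    ModularForm.eta (-1 / z) ^ 2 = zeta12 (-3) * z * ModularForm.eta z ^ 2 := by
  have hz0 : z ≠ 0 := by rintro rfl; simp at hz
  have hsq : ∀ w : ℂ, w ≠ 0 → Complex.sqrt w ^ 2 = w := fun w hw => by
    simp [Complex.sqrt]
  have := ModularForm.eta_comp_eq_csqrt_I_inv hz
  simp only [Function.comp_apply, Pi.smul_apply, Pi.mul_apply, smul_eq_mul] at this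
  rw [this, mul_pow, mul_pow, inv_pow, hsq _ hz0, hsq _ Complex.I_ne_zero, zeta12_neg_three]
  ring

lemma det_eq (γ : SL(2, ℤ)) : γ 0 0 * γ 1 1 - γ 0 1 * γ 1 0 = 1 := by
  rw [← Matrix.det_fin_two, γ.det_coe]

lemma autFactor_ne_zero (γ : SL(2, ℤ)) (τ : ℍ) : autFactor γ τ ≠ 0 := by
  have := UpperHalfPlane.denom_ne_zero (γ : GL (Fin 2) ℝ) τ
  rwa [ModularGroup.denom_apply] at this

lemma coe_smul_eq (γ : SL(2, ℤ)) (τ : ℍ) :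
    ((γ • τ : ℍ) : ℂ) = ((γ 0 0 : ℂ) * τ + (γ 0 1 : ℂ)) / autFactor γ τ := by
  rw [UpperHalfPlane.coe_specialLinearGroup_apply]
  simp [autFactor]

lemma autFactor_mul (γ δ : SL(2, ℤ)) (τ : ℍ) :
    autFactor (γ * δ) τ = autFactor γ (δ • τ) * autFactor δ τ := by
  have h := autFactor_ne_zero δ τ
  conv_rhs => rw [autFactor, coe_smul_eq]
  field_simp
  simp only [autFactor, Matrix.SpecialLinearGroup.coe_mul, Matrix.mul_apply, Fin.sum_univ_two]
  push_cast
  ring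

/-- The transformation law of `η²` under a fixed element of `SL(2, ℤ)`. -/
def EtaSqLaw (γ : SL(2, ℤ)) : Prop :=
  ∀ τ : ℍ, ModularForm.eta (γ • τ : ℍ) ^ 2 =
    zeta12 (etaExp (γ 0 0) (γ 0 1) (γ 1 0) (γ 1 1)) * autFactor γ τ * ModularForm.eta τ ^ 2

lemma eta_sq_T_smul (γ : SL(2, ℤ)) (τ : ℍ) : ModularForm.eta ((ModularGroup.T * γ) • τ : ℍ) ^ 2 =
    zeta12 1 * ModularForm.eta (γ • τ : ℍ) ^ 2 := by
  rw [mul_smul, UpperHalfPlane.modular_T_smul, ← eta_add_one_sq]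
  congr 2
  simp [add_comm]

lemma eta_sq_S_smul (γ : SL(2, ℤ)) (τ : ℍ) : ModularForm.eta ((ModularGroup.S * γ) • τ : ℍ) ^ 2 =
    zeta12 (-3) * (γ • τ : ℍ) * ModularForm.eta (γ • τ : ℍ) ^ 2 := by
  rw [mul_smul, UpperHalfPlane.modular_S_smul, ← eta_neg_inv_sq (γ • τ).im_pos]
  congr 2
  simp [neg_div, inv_neg]

/-- An equivalence is needed, since the induction over the subgroup closure also multiplies by
inverses of generators. -/
lemma etaSqLaw_T_mul (γ : SL(2, ℤ)) : EtaSqLaw (ModularGroup.T * γ) ↔ EtaSqLaw γ := by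
  have h : zeta12 (etaExp ((ModularGroup.T * γ) 0 0) ((ModularGroup.T * γ) 0 1)
      ((ModularGroup.T * γ) 1 0) ((ModularGroup.T * γ) 1 1)) =
      zeta12 1 * zeta12 (etaExp (γ 0 0) (γ 0 1) (γ 1 0) (γ 1 1)) := by
    rw [← zeta12_add, add_comm 1]
    apply zeta12_congr
    simpa [ModularGroup.coe_T, Matrix.mul_apply, Matrix.SpecialLinearGroup.coe_mul] using etaExp_T (det_eq γ)
  have h2 : ∀ τ, autFactor (ModularGroup.T * γ) τ = autFactor γ τ := by
    intro τ; simp [autFactor]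
  unfold EtaSqLaw
  refine forall_congr' fun τ => ?_
  rw [eta_sq_T_smul, h, h2]
  simp only [mul_assoc]
  exact mul_right_inj' (zeta12_ne_zero 1)

lemma etaSqLaw_S_mul (γ : SL(2, ℤ)) : EtaSqLaw (ModularGroup.S * γ) ↔ EtaSqLaw γ := by
  have h : zeta12 (etaExp ((ModularGroup.S * γ) 0 0) ((ModularGroup.S * γ) 0 1)
      ((ModularGroup.S * γ) 1 0) ((ModularGroup.S * γ) 1 1)) =
      zeta12 (-3) * zeta12 (etaExp (γ 0 0) (γ 0 1) (γ 1 0) (γ 1 1)) := by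
    rw [← zeta12_add, add_comm (-3)]
    apply zeta12_congr
    simpa [ModularGroup.coe_S, Matrix.mul_apply, Matrix.SpecialLinearGroup.coe_mul, sub_eq_add_neg] using etaExp_S (det_eq γ)
  have h2 : ∀ τ, autFactor (ModularGroup.S * γ) τ = (γ • τ : ℍ) * autFactor γ τ := by
    intro τ
    rw [autFactor_mul]
    congr 1
    simp [autFactor, ModularGroup.S]
  unfold EtaSqLaw
  refine forall_congr' fun τ => ?_
  rw [eta_sq_S_smul, h, h2]
  have h3 : zeta12 (-3) * ((γ • τ : ℍ) : ℂ) ≠ 0 := mul_ne_zero (zeta12_ne_zero _) (γ • τ).ne_zero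
  rw [show ∀ x z e : ℂ, zeta12 (-3) * x * ((γ • τ : ℍ) * z) * e =
    zeta12 (-3) * ((γ • τ : ℍ) : ℂ) * (x * z * e) by intros; ring]
  exact mul_right_inj' h3

/-- The transformation law of `η²` under `SL(2, ℤ)`. -/
theorem eta_sq_smul (γ : SL(2, ℤ)) : EtaSqLaw γ := by
  have hγ : γ ∈ Subgroup.closure {ModularGroup.S, ModularGroup.T} := by
    simp [SpecialLinearGroup.SL2Z_generators]
  induction hγ using Subgroup.closure_induction_left with
  | one => intro τ; simp [etaExp, autFactor, zeta12]
  | mul_left x hx y hy ih =>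
    rcases hx with rfl | rfl
    · exact (etaSqLaw_S_mul y).2 ih
    · exact (etaSqLaw_T_mul y).2 ih
  | inv_mul_cancel x hx y hy ih =>
    rcases hx with rfl | rfl
    · rw [← etaSqLaw_S_mul]; simpa using ih
    · rw [← etaSqLaw_T_mul]; simpa using ih

/-! ### Modularity of `y`, `b₀²`, `g₆` and `g₄` under `Γ₁(6)`. -/

/-- `N · γτ = δ(Nτ)` for `δ = (a, Nb; c/N, d)`, and `δ` has at `Nτ` the same automorphic factor as
`γ` at `τ`. -/
lemma eta_sq_nat_mul_smul {γ : SL(2, ℤ)} {N : ℕ} (hN : 0 < N) {c' : ℤ} (hc : γ 1 0 = N * c')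
    (τ : ℍ) : ModularForm.eta (N * (γ • τ : ℍ)) ^ 2 =
      zeta12 (etaExp (γ 0 0) (N * γ 0 1) c' (γ 1 1)) * autFactor γ τ *
        ModularForm.eta (N * τ) ^ 2 := by
  have hdet : (!![γ 0 0, N * γ 0 1; c', γ 1 1] : Matrix (Fin 2) (Fin 2) ℤ).det = 1 := by
    rw [Matrix.det_fin_two_of]
    linear_combination det_eq γ + γ 0 1 * hc
  have hN' : (N : ℂ) ≠ 0 := by exact_mod_cast hN.ne'
  let σ : ℍ := ⟨N * τ, by simpa using mul_pos (Nat.cast_pos.2 hN) τ.im_pos⟩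
  have hσ : ((σ : ℍ) : ℂ) = N * τ := rfl
  let δ : SL(2, ℤ) := ⟨_, hdet⟩
  have h00 : δ 0 0 = γ 0 0 := rfl
  have h01 : δ 0 1 = N * γ 0 1 := rfl
  have h10 : δ 1 0 = c' := rfl
  have h11 : δ 1 1 = γ 1 1 := rfl
  have hJ : autFactor δ σ = autFactor γ τ := by
    rw [autFactor, autFactor, h10, h11, hc, hσ]
    push_cast
    ring
  have h := eta_sq_smul δ σ
  rw [hJ, hσ, h00, h01, h10, h11] at h
  rw [← h, coe_smul_eq, coe_smul_eq, hJ, hσ, h00, h01]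
  congr 2
  push_cast
  ring

/-- The last relation is the determinant condition divided by 6. Undivided, it would be vacuous
modulo 3 and too weak for the finite checks on multipliers. -/
lemma gamma1_six {γ : SL(2, ℤ)} (hγ : γ ∈ CongruenceSubgroup.Gamma1 6) :
    ∃ a' c' d' : ℤ, γ 0 0 = 1 + 6 * a' ∧ γ 1 0 = 6 * c' ∧ γ 1 1 = 1 + 6 * d' ∧
      a' + d' + 6 * a' * d' - γ 0 1 * c' = 0 := by
  rw [CongruenceSubgroup.Gamma1_mem] at hγ
  obtain ⟨ha, hd, hc⟩ := hγ
  have ha' : ((γ 0 0 - 1 : ℤ) : ZMod 6) = 0 := by push_cast; rw [ha]; simp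
  have hd' : ((γ 1 1 - 1 : ℤ) : ZMod 6) = 0 := by push_cast; rw [hd]; simp
  rw [ZMod.intCast_zmod_eq_zero_iff_dvd] at ha' hd'
  have hc' := (ZMod.intCast_zmod_eq_zero_iff_dvd _ _).1 hc
  obtain ⟨a, ha⟩ := ha'
  obtain ⟨c, hc⟩ := hc'
  obtain ⟨d, hd⟩ := hd'
  push_cast at ha hc hd
  refine ⟨a, c, d, by linarith, hc, by linarith, ?_⟩
  have h := det_eq γ
  rw [show γ 0 0 = 1 + 6 * a by linarith, hc, show γ 1 1 = 1 + 6 * d by linarith] at h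
  linarith

/-- The coefficients 2, 4, 2, 4 are half the exponents of `η` in `y`: the relation says that the
multipliers cancel. -/
lemma y_exp_mod_three : ∀ a b c d : ZMod 3, a + d + 6 * a * d - b * c = 0 →
    2 * etaExp (1 + 6 * a) (1 * b) (6 * c) (1 + 6 * d) + 4 * etaExp (1 + 6 * a) (6 * b) c (1 + 6 * d)
    - (2 * etaExp (1 + 6 * a) (3 * b) (2 * c) (1 + 6 * d)
    + 4 * etaExp (1 + 6 * a) (2 * b) (3 * c) (1 + 6 * d)) = 0 := by
  unfold etaExp; decide

lemma y_exp_mod_four : ∀ a b c d : ZMod 4, a + d + 6 * a * d - b * c = 0 →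
    2 * etaExp (1 + 6 * a) (1 * b) (6 * c) (1 + 6 * d) + 4 * etaExp (1 + 6 * a) (6 * b) c (1 + 6 * d)
    - (2 * etaExp (1 + 6 * a) (3 * b) (2 * c) (1 + 6 * d)
    + 4 * etaExp (1 + 6 * a) (2 * b) (3 * c) (1 + 6 * d)) = 0 := by
  unfold etaExp; decide

/-- The coefficients 6, 1, 3, 2 are the exponents of `η²` in `b₀²`. -/
lemma b0_exp_mod_three : ∀ a b c d : ZMod 3, a + d + 6 * a * d - b * c = 0 →
    6 * etaExp (1 + 6 * a) (2 * b) (3 * c) (1 + 6 * d) + etaExp (1 + 6 * a) (3 * b) (2 * c) (1 + 6 * d)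
    - (3 * etaExp (1 + 6 * a) (1 * b) (6 * c) (1 + 6 * d)
    + 2 * etaExp (1 + 6 * a) (6 * b) c (1 + 6 * d)) = 0 := by
  unfold etaExp; decide

lemma b0_exp_mod_four : ∀ a b c d : ZMod 4, a + d + 6 * a * d - b * c = 0 →
    6 * etaExp (1 + 6 * a) (2 * b) (3 * c) (1 + 6 * d) + etaExp (1 + 6 * a) (3 * b) (2 * c) (1 + 6 * d)
    - (3 * etaExp (1 + 6 * a) (1 * b) (6 * c) (1 + 6 * d)
    + 2 * etaExp (1 + 6 * a) (6 * b) c (1 + 6 * d)) = 0 := by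
  unfold etaExp; decide

lemma y_exp {a b c d : ℤ} (h : a + d + 6 * a * d - b * c = 0) :
    12 ∣ 2 * etaExp (1 + 6 * a) (1 * b) (6 * c) (1 + 6 * d)
      + 4 * etaExp (1 + 6 * a) (6 * b) c (1 + 6 * d)
      - (2 * etaExp (1 + 6 * a) (3 * b) (2 * c) (1 + 6 * d)
      + 4 * etaExp (1 + 6 * a) (2 * b) (3 * c) (1 + 6 * d)) := by
  apply int_dvd_of_mod_three_four
  · have := congrArg (Int.cast : ℤ → ZMod 3) h
    push_cast at this
    have := y_exp_mod_three _ _ _ _ this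
    push_cast [etaExp_cast]
    exact this
  · have := congrArg (Int.cast : ℤ → ZMod 4) h
    push_cast at this
    have := y_exp_mod_four _ _ _ _ this
    push_cast [etaExp_cast]
    exact this

lemma b0_exp {a b c d : ℤ} (h : a + d + 6 * a * d - b * c = 0) :
    12 ∣ 6 * etaExp (1 + 6 * a) (2 * b) (3 * c) (1 + 6 * d)
      + etaExp (1 + 6 * a) (3 * b) (2 * c) (1 + 6 * d)
      - (3 * etaExp (1 + 6 * a) (1 * b) (6 * c) (1 + 6 * d)
      + 2 * etaExp (1 + 6 * a) (6 * b) c (1 + 6 * d)) := by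
  apply int_dvd_of_mod_three_four
  · have := congrArg (Int.cast : ℤ → ZMod 3) h
    push_cast at this
    have := b0_exp_mod_three _ _ _ _ this
    push_cast [etaExp_cast]
    exact this
  · have := congrArg (Int.cast : ℤ → ZMod 4) h
    push_cast at this
    have := b0_exp_mod_four _ _ _ _ this
    push_cast [etaExp_cast]
    exact this

lemma im_nat_mul_pos {N : ℕ} (hN : 0 < N) (τ : ℍ) : 0 < ((N : ℂ) * τ).im := by
  simpa using mul_pos (Nat.cast_pos.2 hN) τ.im_pos

lemma eta_nat_mul_ne_zero {N : ℕ} (hN : 0 < N) (τ : ℍ) : ModularForm.eta (N * τ) ≠ 0 :=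
  ModularForm.eta_ne_zero (im_nat_mul_pos hN τ)

/-- The transformation law of `η(Nτ)²`, `N ∣ 6`, under `Γ₁(6)`. -/
lemma eta_sq_gamma1_six {γ : SL(2, ℤ)} (hγ : γ ∈ CongruenceSubgroup.Gamma1 6) (τ : ℍ) :
    ∃ z₁ z₂ z₃ z₆ : ℂ, z₁ ^ 2 * z₆ ^ 4 = z₃ ^ 2 * z₂ ^ 4 ∧ z₂ ^ 6 * z₃ = z₁ ^ 3 * z₆ ^ 2 ∧
      z₁ ≠ 0 ∧ z₂ ≠ 0 ∧ z₃ ≠ 0 ∧ z₆ ≠ 0 ∧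
      ModularForm.eta (γ • τ : ℍ) ^ 2 = z₁ * autFactor γ τ * ModularForm.eta τ ^ 2 ∧
      ModularForm.eta (2 * (γ • τ : ℍ)) ^ 2 = z₂ * autFactor γ τ * ModularForm.eta (2 * τ) ^ 2 ∧
      ModularForm.eta (3 * (γ • τ : ℍ)) ^ 2 = z₃ * autFactor γ τ * ModularForm.eta (3 * τ) ^ 2 ∧
      ModularForm.eta (6 * (γ • τ : ℍ)) ^ 2 = z₆ * autFactor γ τ * ModularForm.eta (6 * τ) ^ 2 := by
  obtain ⟨a, c, d, ha, hc, hd, h⟩ := gamma1_six hγ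
  have h1 := eta_sq_nat_mul_smul (γ := γ) (N := 1) (c' := 6 * c) one_pos (by push_cast; linarith) τ
  have h2 := eta_sq_nat_mul_smul (γ := γ) (N := 2) (c' := 3 * c) two_pos (by push_cast; linarith) τ
  have h3 := eta_sq_nat_mul_smul (γ := γ) (N := 3) (c' := 2 * c) three_pos (by push_cast; linarith) τ
  have h6 := eta_sq_nat_mul_smul (γ := γ) (N := 6) (c' := c) (by norm_num) (by push_cast; linarith) τ
  rw [ha, hd] at h1 h2 h3 h6
  refine ⟨_, _, _, _, ?_, ?_, zeta12_ne_zero _, zeta12_ne_zero _, zeta12_ne_zero _,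
    zeta12_ne_zero _, by simpa only [Nat.cast_one, one_mul] using h1, h2, h3, h6⟩
  · have := zeta12_congr (y_exp h)
    simp only [one_mul, zeta12_add, mul_comm (2 : ℤ) (etaExp _ _ _ _),
      mul_comm (4 : ℤ) (etaExp _ _ _ _), zeta12_mul] at this
    simpa using mod_cast this
  · have := zeta12_congr (b0_exp h)
    simp only [one_mul, zeta12_add, mul_comm (2 : ℤ) (etaExp _ _ _ _), mul_comm (3 : ℤ) (etaExp _ _ _ _),
      mul_comm (6 : ℤ) (etaExp _ _ _ _), zeta12_mul] at this
    simpa using mod_cast this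

theorem y_smul {γ : SL(2, ℤ)} (hγ : γ ∈ CongruenceSubgroup.Gamma1 6) (τ : ℍ) :
    y (γ • τ) = y τ := by
  obtain ⟨z₁, z₂, z₃, z₆, hz, -, n1, n2, n3, n6, h1, h2, h3, h6⟩ := eta_sq_gamma1_six hγ τ
  have hJ := autFactor_ne_zero γ τ
  have e2 := eta_nat_mul_ne_zero two_pos τ
  have e3 := eta_nat_mul_ne_zero three_pos τ
  push_cast at e2 e3
  have p : ∀ x : ℂ, x ^ 4 = (x ^ 2) ^ 2 := fun x => by ring
  have q : ∀ x : ℂ, x ^ 8 = (x ^ 2) ^ 4 := fun x => by ring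
  unfold y
  rw [p (ModularForm.eta (γ • τ : ℍ)), q (ModularForm.eta (6 * (γ • τ : ℍ))),
    p (ModularForm.eta (3 * (γ • τ : ℍ))), q (ModularForm.eta (2 * (γ • τ : ℍ))), h1, h2, h3, h6,
    div_eq_div_iff (by positivity) (by positivity)]
  linear_combination 9 * autFactor γ τ ^ 6 * ModularForm.eta τ ^ 4 * ModularForm.eta (6 * τ) ^ 8 *
    ModularForm.eta (3 * τ) ^ 4 * ModularForm.eta (2 * τ) ^ 8 * hz

/-- `b₀` contains odd powers of `η`, so the law of `η²` only controls its square. This suffices,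
because only `b₀^4` and `b₀^6` enter `g₄` and `g₆`. -/
theorem b0_sq_smul {γ : SL(2, ℤ)} (hγ : γ ∈ CongruenceSubgroup.Gamma1 6) (τ : ℍ) :
    b0 (γ • τ) ^ 2 = autFactor γ τ ^ 2 * b0 τ ^ 2 := by
  obtain ⟨z₁, z₂, z₃, z₆, -, hz, n1, n2, n3, n6, h1, h2, h3, h6⟩ := eta_sq_gamma1_six hγ τ
  have hJ := autFactor_ne_zero γ τ
  have e1 := eta_nat_mul_ne_zero one_pos τ
  have e6 := eta_nat_mul_ne_zero (N := 6) (by norm_num) τ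
  push_cast at e1 e6
  rw [one_mul] at e1
  have key : ∀ k a b c d : ℂ, (k * (b ^ 6 * c) / (a ^ 3 * d ^ 2)) ^ 2 =
      k ^ 2 * ((b ^ 2) ^ 6 * c ^ 2) / ((a ^ 2) ^ 3 * (d ^ 2) ^ 2) := by
    intro k a b c d
    rw [div_pow]; ring
  unfold b0
  rw [key, key, h1, h2, h3, h6, ← mul_div_assoc,
    div_eq_div_iff (by positivity) (by positivity)]
  generalize ((2 / 3 : ℂ) * (Real.sqrt 3 : ℂ)) ^ 2 = k
  linear_combination k * autFactor γ τ ^ 7 * ModularForm.eta (2 * τ) ^ 12 *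
    ModularForm.eta (3 * τ) ^ 2 * ModularForm.eta τ ^ 6 * ModularForm.eta (6 * τ) ^ 4 * hz

theorem g6_smul {γ : SL(2, ℤ)} (hγ : γ ∈ CongruenceSubgroup.Gamma1 6) (τ : ℍ) :
    g6 (γ • τ) = autFactor γ τ ^ 6 * g6 τ := by
  have h : b0 (γ • τ) ^ 6 = autFactor γ τ ^ 6 * b0 τ ^ 6 := by
    rw [show 6 = 2 * 3 by norm_num, pow_mul, b0_sq_smul hγ]; ring
  unfold g6
  rw [y_smul hγ, h]
  ring

theorem g4_smul {γ : SL(2, ℤ)} (hγ : γ ∈ CongruenceSubgroup.Gamma1 6) (τ : ℍ) :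
    g4 (γ • τ) = autFactor γ τ ^ 4 * g4 τ := by
  have h : b0 (γ • τ) ^ 4 = autFactor γ τ ^ 4 * b0 τ ^ 4 := by
    rw [show 4 = 2 * 2 by norm_num, pow_mul, b0_sq_smul hγ]; ring
  unfold g4
  rw [y_smul hγ, h]
  ring

lemma smul_mem_poles {γ : SL(2, ℤ)} (hγ : γ ∈ CongruenceSubgroup.Gamma1 6) (τ : ℍ) :
    γ • τ ∈ poles ↔ τ ∈ poles := by
  simp only [poles, mem_ofPred_eq, y_smul hγ]

/-! ### Holomorphy of `g₆` away from `y = ±3`. -/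

/-- The form `g₆` as a function on the complex plane. -/
def g6C (z : ℂ) : ℂ := g6 (UpperHalfPlane.ofComplex z)

/-- The complement of the poles, as a subset of the complex plane. -/
def regularSet : Set ℂ := {z | 0 < z.im ∧ UpperHalfPlane.ofComplex z ∉ poles}

lemma coe_mem_regularSet {τ : ℍ} : (τ : ℂ) ∈ regularSet ↔ τ ∉ poles := by
  simp [regularSet, τ.im_pos]

lemma g6C_coe (τ : ℍ) : g6C τ = g6 τ := by simp [g6C]

lemma differentiableAt_eta_nat_mul {N : ℕ} (hN : 0 < N) {z : ℂ} (hz : 0 < z.im) :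
    DifferentiableAt ℂ (fun z : ℂ => ModularForm.eta (N * z)) z := by
  have h : 0 < ((N : ℂ) * z).im := im_nat_mul_pos hN ⟨z, hz⟩
  have h1 : DifferentiableAt ℂ ModularForm.eta ((N : ℂ) * z) :=
    ModularForm.differentiableAt_eta_of_mem_upperHalfPlaneSet h
  exact h1.comp z (by fun_prop)

lemma eventuallyEq_ofComplex {f : ℍ → ℂ} {g : ℂ → ℂ} (h : ∀ τ : ℍ, f τ = g τ) {z : ℂ}
    (hz : 0 < z.im) : (fun z => f (UpperHalfPlane.ofComplex z)) =ᶠ[𝓝 z] g := by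
  filter_upwards [UpperHalfPlane.eventuallyEq_coe_comp_ofComplex hz] with w hw
  rw [h]
  exact congrArg g hw

lemma differentiableAt_y {z : ℂ} (hz : 0 < z.im) :
    DifferentiableAt ℂ (fun z => y (UpperHalfPlane.ofComplex z)) z := by
  refine DifferentiableAt.congr_of_eventuallyEq ?_ (eventuallyEq_ofComplex (g := fun z =>
    9 * (ModularForm.eta z ^ 4 * ModularForm.eta (6 * z) ^ 8) /
    (ModularForm.eta (3 * z) ^ 4 * ModularForm.eta (2 * z) ^ 8)) (fun τ => rfl) hz)
  have h1 := differentiableAt_eta_nat_mul one_pos hz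
  have h2 := differentiableAt_eta_nat_mul two_pos hz
  have h3 := differentiableAt_eta_nat_mul three_pos hz
  have h6 := differentiableAt_eta_nat_mul (N := 6) (by norm_num) hz
  have e2 := eta_nat_mul_ne_zero two_pos ⟨z, hz⟩
  have e3 := eta_nat_mul_ne_zero three_pos ⟨z, hz⟩
  simp only [Nat.cast_one, one_mul, Nat.cast_ofNat] at *
  exact (((h1.pow 4).mul (h6.pow 8)).const_mul 9).div ((h3.pow 4).mul (h2.pow 8))
    (mul_ne_zero (pow_ne_zero _ e3) (pow_ne_zero _ e2))

lemma differentiableAt_b0 {z : ℂ} (hz : 0 < z.im) :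
    DifferentiableAt ℂ (fun z => b0 (UpperHalfPlane.ofComplex z)) z := by
  refine DifferentiableAt.congr_of_eventuallyEq ?_ (eventuallyEq_ofComplex (g := fun z =>
    (2 / 3 : ℂ) * (Real.sqrt 3 : ℂ) * (ModularForm.eta (2 * z) ^ 6 * ModularForm.eta (3 * z)) /
    (ModularForm.eta z ^ 3 * ModularForm.eta (6 * z) ^ 2)) (fun τ => rfl) hz)
  have h1 := differentiableAt_eta_nat_mul one_pos hz
  have h2 := differentiableAt_eta_nat_mul two_pos hz
  have h3 := differentiableAt_eta_nat_mul three_pos hz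
  have h6 := differentiableAt_eta_nat_mul (N := 6) (by norm_num) hz
  have e1 := eta_nat_mul_ne_zero one_pos ⟨z, hz⟩
  have e6 := eta_nat_mul_ne_zero (N := 6) (by norm_num) ⟨z, hz⟩
  simp only [Nat.cast_one, one_mul, Nat.cast_ofNat] at *
  exact (((h2.pow 6).mul h3).const_mul _).div ((h1.pow 3).mul (h6.pow 2))
    (mul_ne_zero (pow_ne_zero _ e1) (pow_ne_zero _ e6))

lemma differentiableAt_g6C {z : ℂ} (hz : z ∈ regularSet) : DifferentiableAt ℂ g6C z := by
  obtain ⟨h0, hp⟩ := hz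
  have hy := differentiableAt_y h0
  have hb := differentiableAt_b0 h0
  have h3 : y (UpperHalfPlane.ofComplex z) - 3 ≠ 0 := fun h => hp (Or.inl (sub_eq_zero.1 h))
  have h3' : y (UpperHalfPlane.ofComplex z) + 3 ≠ 0 :=
    fun h => hp (Or.inr (eq_neg_of_add_eq_zero_left h))
  unfold g6C g6
  refine DifferentiableAt.mul (DifferentiableAt.div (by fun_prop) (by fun_prop) ?_) (hb.pow 6)
  exact mul_ne_zero (mul_ne_zero (by norm_num) (pow_ne_zero _ h3)) (pow_ne_zero _ h3')

lemma isOpen_regularSet : IsOpen regularSet := by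
  rw [isOpen_iff_mem_nhds]
  rintro z ⟨h0, hp⟩
  have hy := (differentiableAt_y h0).continuousAt
  have h3 := hy.eventually_ne (fun h => hp (Or.inl h))
  have h3' := hy.eventually_ne (fun h => hp (Or.inr h))
  filter_upwards [h3, h3', (isOpen_lt continuous_const Complex.continuous_im).mem_nhds h0]
    with w a b c
  exact ⟨c, fun h => h.elim a b⟩

/-! ### Behaviour of `y`, `b₀` and `g₆` at `i∞`. -/

/-- The filter of points tending to `i∞`. -/
abbrev imInfty : Filter ℂ := comap Complex.im atTop

lemma tendsto_nat_mul_imInfty {N : ℕ} (hN : 0 < N) :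
    Tendsto (fun z : ℂ => (N : ℂ) * z) imInfty imInfty := by
  rw [tendsto_comap_iff]
  have : (Complex.im ∘ fun z : ℂ => (N : ℂ) * z) = fun z => (N : ℝ) * z.im := by
    ext z; simp
  rw [this]
  exact tendsto_comap.const_mul_atTop (Nat.cast_pos.2 hN)

/-- The product `∏ (1 - q(Nz)ⁿ)`. -/
def etaProd (N : ℕ) (z : ℂ) : ℂ := ∏' n, (1 - ModularForm.eta_q n (N * z))

/-- The product is holomorphic in `q` on the unit disc and equals 1 at `q = 0`. -/
lemma tendsto_etaProd {N : ℕ} (hN : 0 < N) : Tendsto (etaProd N) imInfty (𝓝 1) := by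
  have h := (ModularForm.differentiableOn_tprod_one_sub_pow.differentiableAt
    (Metric.ball_mem_nhds (0 : ℂ) one_pos)).continuousAt.tendsto
  simp only [ne_eq, Nat.succ_ne_zero, not_false_eq_true, zero_pow, sub_zero, tprod_one] at h
  exact (h.mono_left nhdsWithin_le_nhds).comp
    ((Function.Periodic.qParam_tendsto one_pos).comp (tendsto_nat_mul_imInfty hN))

lemma eta_nat_mul_eq (N : ℕ) (z : ℂ) : ModularForm.eta (N * z) =
    Function.Periodic.qParam 24 z ^ N * etaProd N z := by
  rw [ModularForm.eta, etaProd]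
  congr 1
  simp only [Function.Periodic.qParam, ← Complex.exp_nat_mul]
  congr 1
  ring

lemma qParam_pow_24 (z : ℂ) :
    Function.Periodic.qParam 24 z ^ 24 = Function.Periodic.qParam 1 z := by
  simp only [Function.Periodic.qParam, ← Complex.exp_nat_mul]
  congr 1
  push_cast
  ring

lemma eventually_im_pos : ∀ᶠ z : ℂ in imInfty, 0 < z.im :=
  tendsto_comap.eventually (eventually_gt_atTop 0)

/-- In powers of `q^(1/24)` the numerator has order `4 + 8·6 = 52` and the denominator `4·3 + 8·2 =
28`. After cancelling 28 a factor `q` remains. -/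
lemma tendsto_y : Tendsto (fun z => y (UpperHalfPlane.ofComplex z)) imInfty (𝓝 0) := by
  have h1 := tendsto_etaProd one_pos
  have h2 := tendsto_etaProd two_pos
  have h3 := tendsto_etaProd three_pos
  have h6 := tendsto_etaProd (N := 6) (by norm_num)
  have hq : Tendsto (Function.Periodic.qParam 1) imInfty (𝓝 0) :=
    (Function.Periodic.qParam_tendsto one_pos).mono_right nhdsWithin_le_nhds
  have h := (hq.const_mul 9).mul (((h1.pow 4).mul (h6.pow 8)).div ((h3.pow 4).mul (h2.pow 8))
    (by norm_num))
  simp only [mul_zero, zero_mul] at h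
  refine h.congr' ?_
  filter_upwards [eventually_im_pos] with z hz
  have hz' := UpperHalfPlane.ofComplex_apply ⟨z, hz⟩
  change UpperHalfPlane.ofComplex z = _ at hz'
  have hq0 := Function.Periodic.qParam_ne_zero (h := 24) z
  have e1 := eta_nat_mul_eq 1 z
  have e2 := eta_nat_mul_eq 2 z
  have e3 := eta_nat_mul_eq 3 z
  have e6 := eta_nat_mul_eq 6 z
  simp only [Nat.cast_one, one_mul, Nat.cast_ofNat] at e1 e2 e3 e6
  rw [hz', y]
  change _ = 9 * (ModularForm.eta z ^ 4 * ModularForm.eta (6 * z) ^ 8) /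
    (ModularForm.eta (3 * z) ^ 4 * ModularForm.eta (2 * z) ^ 8)
  rw [e1, e2, e3, e6, ← qParam_pow_24, Pi.div_apply, ← mul_div_assoc]
  refine (mul_div_mul_left _ _ (pow_ne_zero 28 hq0)).symm.trans ?_
  congr 1 <;> ring

/-- Numerator and denominator both have order 15 in `q^(1/24)`, so the limit is the leading
constant. -/
lemma tendsto_b0 : Tendsto (fun z => b0 (UpperHalfPlane.ofComplex z)) imInfty
    (𝓝 ((2 / 3 : ℂ) * (Real.sqrt 3 : ℂ))) := by
  have h1 := tendsto_etaProd one_pos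
  have h2 := tendsto_etaProd two_pos
  have h3 := tendsto_etaProd three_pos
  have h6 := tendsto_etaProd (N := 6) (by norm_num)
  have h := (((h2.pow 6).mul h3).const_mul ((2 / 3 : ℂ) * (Real.sqrt 3 : ℂ))).div
    ((h1.pow 3).mul (h6.pow 2)) (by norm_num)
  simp only [one_pow, mul_one, div_one] at h
  refine h.congr' ?_
  filter_upwards [eventually_im_pos] with z hz
  have hz' := UpperHalfPlane.ofComplex_apply ⟨z, hz⟩
  change UpperHalfPlane.ofComplex z = _ at hz'
  have hq0 := Function.Periodic.qParam_ne_zero (h := 24) z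
  have e1 := eta_nat_mul_eq 1 z
  have e2 := eta_nat_mul_eq 2 z
  have e3 := eta_nat_mul_eq 3 z
  have e6 := eta_nat_mul_eq 6 z
  simp only [Nat.cast_one, one_mul, Nat.cast_ofNat] at e1 e2 e3 e6
  rw [hz', b0]
  change _ = (2 / 3 : ℂ) * (Real.sqrt 3 : ℂ) *
    (ModularForm.eta (2 * z) ^ 6 * ModularForm.eta (3 * z)) /
    (ModularForm.eta z ^ 3 * ModularForm.eta (6 * z) ^ 2)
  rw [e1, e2, e3, e6, Pi.div_apply]
  refine (mul_div_mul_left _ _ (pow_ne_zero 15 hq0)).symm.trans ?_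
  congr 1 <;> ring

/-- The factor `y` makes `g₆` vanish at the cusp; the denominator stays away from zero since `y → 0
≠ ±3`. -/
lemma tendsto_g6C : Tendsto g6C imInfty (𝓝 0) := by
  have hy := tendsto_y
  have hb := tendsto_b0
  have h := ((((((hy.mul (hy.sub_const 1)).mul (hy.sub_const 9)).mul
    (((hy.pow 2).sub (hy.const_mul 2)).add_const 9)).mul
    ((((hy.pow 2).sub (hy.const_mul 18)).add_const 9).pow 3)).div
    ((((hy.sub_const 3).pow 3).const_mul 864).mul ((hy.add_const 3).pow 3)) (by norm_num)).mul
    (hb.pow 6))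
  simp only [zero_mul, zero_div] at h
  exact h

lemma eventually_mem_regularSet : ∀ᶠ z in imInfty, z ∈ regularSet := by
  filter_upwards [eventually_im_pos, tendsto_y.eventually_ne (show (0 : ℂ) ≠ 3 by norm_num),
    tendsto_y.eventually_ne (show (0 : ℂ) ≠ -3 by norm_num)] with z h a b
  exact ⟨h, fun h => h.elim a b⟩

lemma g6C_periodic : Function.Periodic g6C (1 : ℝ) := by
  intro z
  have hT : ModularGroup.T ∈ CongruenceSubgroup.Gamma1 6 := by
    rw [CongruenceSubgroup.Gamma1_mem]
    simp [ModularGroup.coe_T]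
  by_cases hz : 0 < z.im
  · have h := g6_smul hT ⟨z, hz⟩
    have hJ : autFactor ModularGroup.T ⟨z, hz⟩ = 1 := by simp [autFactor, ModularGroup.coe_T]
    rw [hJ, one_pow, one_mul, ← g6C_coe, ← g6C_coe, UpperHalfPlane.modular_T_smul] at h
    simpa [add_comm] using h
  -- Off the upper half plane `ofComplex` has one default value, so periodicity is trivial there.
  · unfold g6C
    rw [UpperHalfPlane.ofComplex_apply_eq_of_im_nonpos (w := z + (1 : ℝ)) (w' := z)]
    · simpa using hz
    · simpa using hz

/-! ### Expansions in `q` and primitives vanishing at `i∞`. -/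

/-- On the half plane `Im z > M`, the function `F` is a power series in `q` without constant
term. -/
def HasCuspExpansion (M : ℝ) (F : ℂ → ℂ) : Prop :=
  ∃ Φ : ℂ → ℂ, DifferentiableOn ℂ Φ (Metric.ball 0 (Real.exp (-2 * Real.pi * M))) ∧ Φ 0 = 0 ∧
    ∀ z : ℂ, M < z.im → F z = Φ (Function.Periodic.qParam 1 z)

lemma qParam_mem_ball {M : ℝ} {z : ℂ} (hz : M < z.im) :
    Function.Periodic.qParam 1 z ∈ Metric.ball (0 : ℂ) (Real.exp (-2 * Real.pi * M)) := by
  rw [mem_ball_zero_iff]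
  simpa using (Function.Periodic.norm_qParam_lt_iff one_pos M z).2 hz

lemma hasDerivAt_qParam (z : ℂ) : HasDerivAt (Function.Periodic.qParam 1)
    (Function.Periodic.qParam 1 z * (2 * Real.pi * Complex.I)) z := by
  unfold Function.Periodic.qParam
  simpa using ((hasDerivAt_id z).const_mul (2 * Real.pi * Complex.I)).cexp

/-- A cusp expansion has a primitive with a cusp expansion. -/
lemma HasCuspExpansion.exists_primitive {M : ℝ} {F : ℂ → ℂ} (hF : HasCuspExpansion M F) :
    ∃ G, HasCuspExpansion M G ∧ ∀ z : ℂ, M < z.im → HasDerivAt G (F z) z := by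
  obtain ⟨Φ, hd, h0, hΦ⟩ := hF
  have hball : Metric.ball (0 : ℂ) (Real.exp (-2 * Real.pi * M)) ∈ 𝓝 (0 : ℂ) :=
    Metric.ball_mem_nhds _ (Real.exp_pos _)
  -- Because `dz = dq / (2πi q)`, the function to integrate is `Φ(q) / q`; it is holomorphic at 0 as
  -- `Φ 0 = 0`, and it is the slope of `Φ` at 0.
  have hs := (Complex.differentiableOn_dslope hball).2 hd
  obtain ⟨Ψ, hΨ0, hΨ⟩ := hs.isExactOn_ball.with_val_at 0 0
  have hw : (2 * Real.pi * Complex.I : ℂ) ≠ 0 := Complex.two_pi_I_ne_zero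
  refine ⟨fun z => Ψ (Function.Periodic.qParam 1 z) / (2 * Real.pi * Complex.I),
    ⟨fun q => Ψ q / (2 * Real.pi * Complex.I), ?_, by simp [hΨ0], fun z _ => rfl⟩, ?_⟩
  · exact fun q hq => ((hΨ q hq).differentiableAt.div_const _).differentiableWithinAt
  · intro z hz
    have h := ((hΨ _ (qParam_mem_ball hz)).comp z (hasDerivAt_qParam z)).div_const
      (2 * Real.pi * Complex.I)
    refine h.congr_deriv ?_
    have h1 := sub_smul_dslope Φ 0 (Function.Periodic.qParam 1 z)
    rw [h0, sub_zero, sub_zero, smul_eq_mul] at h1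
    rw [hΦ z hz, ← h1]
    field_simp

/-- The filter of points tending to `i∞` inside the strip `|Re z| ≤ B`. -/
abbrev strip (B : ℝ) : Filter ℂ := imInfty ⊓ 𝓟 {z | |z.re| ≤ B}

lemma TendsToInfty.exists_tendsto {α : Type} {u : α → ℍ} {l : Filter α} (h : TendsToInfty u l) :
    ∃ B, Tendsto (fun x => (u x : ℂ)) l (strip B) := by
  obtain ⟨h1, B, hB⟩ := h
  refine ⟨B, tendsto_inf.2 ⟨tendsto_comap_iff.2 h1, tendsto_principal.2 hB⟩⟩

/-- `Φ(q) = O(q)` at 0, and `|q| = exp(-2π Im z)`. -/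
lemma HasCuspExpansion.isBigO {M : ℝ} {F : ℂ → ℂ} (hF : HasCuspExpansion M F) :
    F =O[imInfty] fun z => Real.exp (-2 * Real.pi * z.im) := by
  obtain ⟨Φ, hd, h0, hΦ⟩ := hF
  have hball : Metric.ball (0 : ℂ) (Real.exp (-2 * Real.pi * M)) ∈ 𝓝 (0 : ℂ) :=
    Metric.ball_mem_nhds _ (Real.exp_pos _)
  have h1 := (hd.differentiableAt hball).isBigO_sub
  simp only [h0, sub_zero] at h1
  have h2 := h1.comp_tendsto
    ((Function.Periodic.qParam_tendsto one_pos).mono_right nhdsWithin_le_nhds)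
  refine (h2.congr' ?_ (Eventually.of_forall fun _ => rfl)).trans ?_
  · filter_upwards [tendsto_comap.eventually (eventually_gt_atTop M)] with z hz
    exact (hΦ z hz).symm
  · refine Asymptotics.IsBigO.of_norm_eventuallyLE (Eventually.of_forall fun z => ?_)
    simp [Function.Periodic.norm_qParam]

/-- In a strip `|z| ≤ 2 Im z` eventually, so exponential decay beats any power of `z`. This is where
bounded real parts at the cusp are needed. -/
lemma HasCuspExpansion.tendsto_pow_mul {M : ℝ} {F : ℂ → ℂ} (hF : HasCuspExpansion M F) (n : ℕ)
    (B : ℝ) : Tendsto (fun z => z ^ n * F z) (strip B) (𝓝 0) := by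
  have hpow : (fun z : ℂ => z ^ n) =O[strip B] fun z => z.im ^ n := by
    refine Asymptotics.IsBigO.pow (Asymptotics.IsBigO.of_bound 2 ?_) n
    have h1 : ∀ᶠ z in strip B, |B| ≤ z.im :=
      (tendsto_comap.mono_left inf_le_left).eventually (eventually_ge_atTop |B|)
    have h2 : ∀ᶠ z in strip B, z ∈ {z : ℂ | |z.re| ≤ B} := mem_inf_of_right (mem_principal_self _)
    filter_upwards [h1, h2] with z h1 h2
    have h3 := Complex.norm_le_abs_re_add_abs_im z
    have h2' : |z.re| ≤ B := h2
    rw [Real.norm_eq_abs]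
    linarith [le_abs_self B, le_abs_self z.im]
  have h := hpow.mul (hF.isBigO.mono (inf_le_left : strip B ≤ imInfty))
  refine h.trans_tendsto ?_
  have h3 : Tendsto (fun x : ℝ => x ^ n * Real.exp (-2 * Real.pi * x)) atTop (𝓝 0) := by
    have h4 := (Real.tendsto_pow_mul_exp_neg_atTop_nhds_zero n).comp
      ((tendsto_id (α := ℝ)).const_mul_atTop Real.two_pi_pos)
    have h5 := h4.const_mul ((2 * Real.pi) ^ n)⁻¹
    rw [mul_zero] at h5
    refine h5.congr fun x => ?_
    have : (2 * Real.pi) ^ n ≠ 0 := pow_ne_zero _ Real.two_pi_pos.ne'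
    simp only [Function.comp_apply, id]
    rw [mul_pow (2 * Real.pi) x n, mul_assoc, inv_mul_cancel_left₀ this, neg_mul, neg_mul]
  exact h3.comp (tendsto_comap.mono_left inf_le_left)

lemma HasCuspExpansion.tendsto_eval_mul {M : ℝ} {F : ℂ → ℂ} (hF : HasCuspExpansion M F)
    (P : Polynomial ℂ) (B : ℝ) : Tendsto (fun z => P.eval z * F z) (strip B) (𝓝 0) := by
  induction P using Polynomial.induction_on' with
  | add p q hp hq => simpa [add_mul] using hp.add hq
  | monomial n a => simpa [mul_assoc] using (hF.tendsto_pow_mul n B).const_mul a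

/-- A cusp expansion multiplied by a polynomial has a primitive that vanishes at `i∞`. -/
lemma HasCuspExpansion.exists_primitive_eval_mul {M : ℝ} (n : ℕ) : ∀ {F : ℂ → ℂ},
    HasCuspExpansion M F → ∀ P : Polynomial ℂ, Polynomial.derivative^[n] P = 0 →
    ∃ G : ℂ → ℂ, (∀ z : ℂ, M < z.im → HasDerivAt G (P.eval z * F z) z) ∧
      ∀ B, Tendsto G (strip B) (𝓝 0) := by
  induction n with
  | zero =>
    intro F _ P hP
    have hP' : P = 0 := hP
    exact ⟨fun _ => 0, fun z _ => by simpa [hP'] using hasDerivAt_const z (0 : ℂ),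
      fun B => tendsto_const_nhds⟩
  | succ n ih =>
    intro F hF P hP
    obtain ⟨F₁, hF₁, hd⟩ := hF.exists_primitive
    obtain ⟨G, hG, hlim⟩ := ih hF₁ (Polynomial.derivative P) hP
    -- Integration by parts: `∫ P F = P F₁ - ∫ P' F₁`, with one derivative fewer left to kill `P'`.
    refine ⟨fun z => P.eval z * F₁ z - G z, fun z hz => ?_, fun B => ?_⟩
    · refine (((P.hasDerivAt z).mul (hd z hz)).sub (hG z hz)).congr_deriv ?_
      ring
    · simpa using (hF₁.tendsto_eval_mul P B).sub (hlim B)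

/-- A periodic function, holomorphic high up and vanishing at `i∞`, is a function of `q` with a
removable singularity and value 0 at `q = 0`. -/
lemma exists_hasCuspExpansion_g6C : ∃ M : ℝ, HasCuspExpansion M g6C := by
  have hhol : ∀ᶠ z in imInfty, DifferentiableAt ℂ g6C z :=
    eventually_mem_regularSet.mono fun z hz => differentiableAt_g6C hz
  have hzero : ZeroAtFilter imInfty g6C := tendsto_g6C
  have h0 := Function.Periodic.differentiableAt_cuspFunction_zero one_pos g6C_periodic hhol
    hzero.boundedAtFilter
  have h1 := Function.Periodic.eventually_differentiableAt_cuspFunction_nhds_ne_zero one_pos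
    g6C_periodic hhol
  have h2 : ∀ᶠ q in 𝓝 0, DifferentiableAt ℂ (Function.Periodic.cuspFunction 1 g6C) q := by
    rw [eventually_nhdsWithin_iff] at h1
    filter_upwards [h1] with q hq
    by_cases h : q = 0
    · rwa [h]
    · exact hq h
  obtain ⟨ε, hε, hball⟩ := Metric.eventually_nhds_iff_ball.1 h2
  have hlim : Tendsto (fun M : ℝ => Real.exp (-2 * Real.pi * M)) atTop (𝓝 0) := by
    refine Real.tendsto_exp_atBot.comp (tendsto_id.const_mul_atTop_of_neg ?_)
    linarith [Real.pi_pos]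
  obtain ⟨M, hM⟩ := (hlim.eventually (gt_mem_nhds hε)).exists
  refine ⟨M, _, fun q hq => (hball q ?_).differentiableWithinAt, ?_, fun z _ =>
    (Function.Periodic.eq_cuspFunction one_ne_zero g6C_periodic z).symm⟩
  · exact Metric.ball_subset_ball hM.le hq
  · exact Function.Periodic.cuspFunction_zero_of_zero_at_inf one_pos hzero

/-- A height above which the expansion of `g₆` at `i∞` converges. -/
def height : ℝ := exists_hasCuspExpansion_g6C.choose

lemma hasCuspExpansion_g6C : HasCuspExpansion height g6C :=
  exists_hasCuspExpansion_g6C.choose_spec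

/-- The differential form `P g₆`. -/
def form (P : Polynomial ℂ) (z : ℂ) : ℂ := P.eval z * g6C z

lemma differentiableOn_form (P : Polynomial ℂ) : DifferentiableOn ℂ (form P) regularSet :=
  fun _ hz => (P.differentiableAt.mul (differentiableAt_g6C hz)).differentiableWithinAt

lemma exists_cuspPrimitive (P : Polynomial ℂ) :
    ∃ G : ℂ → ℂ, (∀ z : ℂ, height < z.im → HasDerivAt G (form P z) z) ∧
      ∀ B, Tendsto G (strip B) (𝓝 0) :=
  hasCuspExpansion_g6C.exists_primitive_eval_mul (P.natDegree + 1) P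
    (Polynomial.iterate_derivative_eq_zero (Nat.lt_succ_self _))

/-- The primitive of `P g₆` near `i∞` that vanishes at `i∞`. -/
def cuspPrimitive (P : Polynomial ℂ) : ℂ → ℂ := (exists_cuspPrimitive P).choose

lemma hasDerivAt_cuspPrimitive (P : Polynomial ℂ) {z : ℂ} (hz : height < z.im) :
    HasDerivAt (cuspPrimitive P) (form P z) z :=
  (exists_cuspPrimitive P).choose_spec.1 z hz

lemma tendsto_cuspPrimitive (P : Polynomial ℂ) (B : ℝ) :
    Tendsto (cuspPrimitive P) (strip B) (𝓝 0) :=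
  (exists_cuspPrimitive P).choose_spec.2 B

lemma TendsToInfty.tendsto_cuspPrimitive {α : Type} {u : α → ℍ} {l : Filter α}
    (h : TendsToInfty u l) (P : Polynomial ℂ) :
    Tendsto (fun x => cuspPrimitive P (u x)) l (𝓝 0) := by
  obtain ⟨B, hB⟩ := h.exists_tendsto
  exact (Banana.tendsto_cuspPrimitive P B).comp hB

lemma TendsToInfty.eventually_height_lt {α : Type} {u : α → ℍ} {l : Filter α}
    (h : TendsToInfty u l) : ∀ᶠ x in l, height < (u x : ℂ).im :=
  h.1.eventually (eventually_gt_atTop height)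

/-! ### Primitives along continuous curves and Cauchy's theorem for continuous rectangles. -/

/-- `Φ` is a primitive of the differential form `ω(z) dz` along the curve `α` on `J`. -/
def IsPrimitiveAlong (ω : ℂ → ℂ) (α : ℝ → ℂ) (Φ : ℝ → ℂ) (J : Set ℝ) : Prop :=
  ∀ t ∈ J, ∃ G : ℂ → ℂ, (∀ᶠ z in 𝓝 (α t), HasDerivAt G (ω z) z) ∧
    ∀ᶠ u in 𝓝[J] t, Φ u = G (α u)

lemma sub_eq_sub_of_hasDerivAt {ω G₁ G₂ : ℂ → ℂ} {U : Set ℂ} (hU : Convex ℝ U)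
    (h₁ : ∀ z ∈ U, HasDerivAt G₁ (ω z) z) (h₂ : ∀ z ∈ U, HasDerivAt G₂ (ω z) z) {a b : ℂ}
    (ha : a ∈ U) (hb : b ∈ U) : G₁ b - G₁ a = G₂ b - G₂ a := by
  have h := hU.norm_image_sub_le_of_norm_hasDerivWithin_le (f := fun z => G₁ z - G₂ z)
    (f' := fun _ => (0 : ℂ)) (C := 0) (fun z hz =>
      (((h₁ z hz).sub (h₂ z hz)).congr_deriv (sub_self _)).hasDerivWithinAt) (by simp) ha hb
  rw [zero_mul, norm_le_zero_iff] at h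
  linear_combination h

lemma eq_of_locally_const {f : ℝ → ℂ} {J : Set ℝ} (hJ : IsPreconnected J)
    (h : ∀ t ∈ J, ∀ᶠ u in 𝓝[J] t, f u = f t) {s t : ℝ} (hs : s ∈ J) (ht : t ∈ J) :
    f s = f t :=
  hJ.induction₂ (fun x y => f x = f y) (fun x hx => (h x hx).mono fun _ h => h.symm)
    (fun _ _ _ _ _ _ h h' => h.trans h') (fun _ _ _ _ h => h.symm) hs ht

/-- Any local primitive at `α t` may replace the one supplied: the two differ by a constant on a
ball, in which the curve stays for nearby parameters. -/
lemma IsPrimitiveAlong.eventually_sub_eq {ω : ℂ → ℂ} {α : ℝ → ℂ} {Φ : ℝ → ℂ} {J : Set ℝ}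
    (h : IsPrimitiveAlong ω α Φ J) (hα : ContinuousOn α J) {t : ℝ} (ht : t ∈ J) {G : ℂ → ℂ}
    (hG : ∀ᶠ z in 𝓝 (α t), HasDerivAt G (ω z) z) :
    ∀ᶠ u in 𝓝[J] t, Φ u - Φ t = G (α u) - G (α t) := by
  obtain ⟨G', hG', hΦ⟩ := h t ht
  obtain ⟨ε, hε, hball⟩ := Metric.eventually_nhds_iff_ball.1 (hG'.and hG)
  filter_upwards [hΦ, hα t ht (Metric.ball_mem_nhds _ hε)] with u hu hu'
  rw [hu, hΦ.self_of_nhdsWithin ht]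
  exact sub_eq_sub_of_hasDerivAt (convex_ball _ ε) (fun z hz => (hball z hz).1)
    (fun z hz => (hball z hz).2) (Metric.mem_ball_self hε) hu'

lemma IsPrimitiveAlong.mono {ω : ℂ → ℂ} {α : ℝ → ℂ} {Φ : ℝ → ℂ} {J K : Set ℝ}
    (h : IsPrimitiveAlong ω α Φ J) (hK : K ⊆ J) : IsPrimitiveAlong ω α Φ K := by
  intro t ht
  obtain ⟨G, hG, hΦ⟩ := h t (hK ht)
  exact ⟨G, hG, hΦ.filter_mono (nhdsWithin_mono t hK)⟩

lemma IsPrimitiveAlong.congr {ω : ℂ → ℂ} {α β : ℝ → ℂ} {Φ : ℝ → ℂ} {J : Set ℝ}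
    (h : IsPrimitiveAlong ω α Φ J) (hαβ : EqOn α β J) : IsPrimitiveAlong ω β Φ J := by
  intro t ht
  obtain ⟨G, hG, hΦ⟩ := h t ht
  refine ⟨G, hαβ ht ▸ hG, ?_⟩
  filter_upwards [hΦ, self_mem_nhdsWithin] with u hu huJ
  rw [hu, hαβ huJ]

lemma isPrimitiveAlong_comp {ω G : ℂ → ℂ} {α : ℝ → ℂ} {J : Set ℝ} {U : Set ℂ} (hU : IsOpen U)
    (hG : ∀ z ∈ U, HasDerivAt G (ω z) z) (hα : MapsTo α J U) :
    IsPrimitiveAlong ω α (fun t => G (α t)) J :=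
  fun t ht => ⟨G, by filter_upwards [hU.mem_nhds (hα ht)] using hG, Eventually.of_forall
    fun _ => rfl⟩

/-- Primitives along two curves that are uniformly close. -/
lemma IsPrimitiveAlong.sub_eq_of_close {ω : ℂ → ℂ} {α β : ℝ → ℂ} {Φ Ψ : ℝ → ℂ} {J : Set ℝ}
    (hJ : IsPreconnected J) (hα : ContinuousOn α J) (hβ : ContinuousOn β J)
    (hΦ : IsPrimitiveAlong ω α Φ J) (hΨ : IsPrimitiveAlong ω β Ψ J) {ε : ℝ} (hε : 0 < ε)
    {G : ℂ → ℂ → ℂ} (hG : ∀ t ∈ J, ∀ z ∈ Metric.ball (α t) ε, HasDerivAt (G (α t)) (ω z) z)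
    (hclose : ∀ t ∈ J, β t ∈ Metric.ball (α t) ε) {s t : ℝ} (hs : s ∈ J) (ht : t ∈ J) :
    Ψ s - Φ s - (G (α s) (β s) - G (α s) (α s)) =
      Ψ t - Φ t - (G (α t) (β t) - G (α t) (α t)) := by
  refine eq_of_locally_const (f := fun s => Ψ s - Φ s - (G (α s) (β s) - G (α s) (α s))) hJ
    (fun t ht => ?_) hs ht
  have hball : ∀ z ∈ Metric.ball (α t) ε, ∀ᶠ w in 𝓝 z, HasDerivAt (G (α t)) (ω w) w :=
    fun z hz => by filter_upwards [Metric.isOpen_ball.mem_nhds hz] using hG t ht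
  filter_upwards [hΦ.eventually_sub_eq hα ht (hball _ (Metric.mem_ball_self hε)),
    hΨ.eventually_sub_eq hβ ht (hball _ (hclose t ht)),
    hα t ht (Metric.ball_mem_nhds _ hε),
    hβ t ht (Metric.isOpen_ball.mem_nhds (hclose t ht)), self_mem_nhdsWithin]
    with u h₁ h₂ h₃ h₄ hu
  -- The intersection of two neighbouring balls is convex and contains both `α u` and `β u`, so the
  -- primitives of the two balls have the same increment there.
  have := sub_eq_sub_of_hasDerivAt ((convex_ball (α u) ε).inter (convex_ball (α t) ε))
    (fun z hz => hG u hu z hz.1) (fun z hz => hG t ht z hz.2)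
    ⟨Metric.mem_ball_self hε, h₃⟩ ⟨hclose u hu, h₄⟩
  linear_combination h₂ - h₁ - this

lemma IsPrimitiveAlong.sub_eq_sub {ω : ℂ → ℂ} {α : ℝ → ℂ} {Φ Ψ : ℝ → ℂ} {J : Set ℝ}
    (hJ : IsPreconnected J) (hα : ContinuousOn α J) (hΦ : IsPrimitiveAlong ω α Φ J)
    (hΨ : IsPrimitiveAlong ω α Ψ J) {s t : ℝ} (hs : s ∈ J) (ht : t ∈ J) :
    Ψ t - Ψ s = Φ t - Φ s := by
  have : Ψ t - Φ t = Ψ s - Φ s := by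
    refine eq_of_locally_const (f := fun s => Ψ s - Φ s) hJ (fun t ht => ?_) ht hs
    obtain ⟨G, hG, hΦ'⟩ := hΦ t ht
    filter_upwards [hΦ.eventually_sub_eq hα ht hG, hΨ.eventually_sub_eq hα ht hG] with u h₁ h₂
    linear_combination h₂ - h₁
  linear_combination this

/-- The second primitive is shifted by a constant so that both agree at `c`. -/
lemma IsPrimitiveAlong.glue {ω : ℂ → ℂ} {α : ℝ → ℂ} {Φ Ψ : ℝ → ℂ} {a b c : ℝ} (hac : a ≤ c)
    (hcb : c ≤ b) (hα : ContinuousOn α (Icc a b)) (hΦ : IsPrimitiveAlong ω α Φ (Icc a c))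
    (hΨ : IsPrimitiveAlong ω α Ψ (Icc c b)) :
    IsPrimitiveAlong ω α (fun u => if u ≤ c then Φ u else Ψ u - Ψ c + Φ c) (Icc a b) := by
  intro t ht
  rcases lt_trichotomy t c with h | rfl | h
  · obtain ⟨G, hG, h'⟩ := hΦ t ⟨ht.1, h.le⟩
    refine ⟨G, hG, ?_⟩
    rw [eventually_nhdsWithin_iff] at h' ⊢
    filter_upwards [h', gt_mem_nhds h] with u hu huc hu'
    rw [if_pos (le_of_lt huc)]
    exact hu ⟨hu'.1, le_of_lt huc⟩
  · obtain ⟨G, hG, h'⟩ := hΦ t ⟨hac, le_rfl⟩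
    have h'' := hΨ.eventually_sub_eq (hα.mono (Icc_subset_Icc_left hac)) ⟨le_rfl, hcb⟩ hG
    have h0 := h'.self_of_nhdsWithin ⟨hac, le_rfl⟩
    refine ⟨G, hG, ?_⟩
    rw [eventually_nhdsWithin_iff] at h' h'' ⊢
    filter_upwards [h', h''] with u hu hu' hu''
    split_ifs with hut
    · exact hu ⟨hu''.1, hut⟩
    · have := hu' ⟨(not_le.1 hut).le, hu''.2⟩
      linear_combination this + h0
  · obtain ⟨G, hG, h'⟩ := hΨ t ⟨h.le, ht.2⟩
    refine ⟨fun z => G z - Ψ c + Φ c, ?_, ?_⟩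
    · filter_upwards [hG] with z hz
      exact (hz.sub_const _).add_const _
    rw [eventually_nhdsWithin_iff] at h' ⊢
    filter_upwards [h', lt_mem_nhds h] with u hu huc hu'
    rw [if_neg (not_le.2 huc), hu ⟨huc.le, hu'.2⟩]

lemma exists_pos_ball_subset {X K : Set ℂ} (hX : IsOpen X) (hK : IsCompact K) (hKX : K ⊆ X) :
    ∃ ε > 0, ∀ z ∈ K, Metric.ball z ε ⊆ X := by
  obtain ⟨ε, hε, h⟩ := hK.exists_thickening_subset_open hX hKX
  exact ⟨ε, hε, fun z hz => (Metric.ball_subset_thickening hz ε).trans h⟩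

/-- By compactness, parameter intervals of length `δ` are mapped into balls inside `X`, where `ω`
has a primitive; finitely many such pieces are glued. -/
theorem exists_isPrimitiveAlong {ω : ℂ → ℂ} {X : Set ℂ} (hX : IsOpen X)
    (hω : DifferentiableOn ℂ ω X) {α : ℝ → ℂ} {a b : ℝ} (hab : a ≤ b)
    (hα : ContinuousOn α (Icc a b)) (hαX : MapsTo α (Icc a b) X) :
    ∃ Φ, IsPrimitiveAlong ω α Φ (Icc a b) := by
  obtain ⟨ε, hε, hball⟩ := exists_pos_ball_subset hX (isCompact_Icc.image_of_continuousOn hα)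
    hαX.image_subset
  obtain ⟨δ, hδ, hunif⟩ := Metric.uniformContinuousOn_iff_le.1
    (isCompact_Icc.uniformContinuousOn_of_continuous hα) (ε / 2) (half_pos hε)
  have hloc : ∀ c ∈ Icc a b, ∀ x ∈ Icc a b, x - c ≤ δ →
      ∃ Φ, IsPrimitiveAlong ω α Φ (Icc c x) := by
    intro c hc x hx hcx
    obtain ⟨G, hG⟩ := (hω.mono (hball _ (mem_image_of_mem α hc))).isExactOn_ball
    refine ⟨_, isPrimitiveAlong_comp Metric.isOpen_ball hG fun t ht => ?_⟩
    refine (hunif t ⟨hc.1.trans ht.1, ht.2.trans hx.2⟩ c hc ?_).trans_lt (half_lt_self hε)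
    rw [Real.dist_eq, abs_of_nonneg (sub_nonneg.2 ht.1)]
    linarith [ht.2]
  have hind : ∀ n : ℕ, ∀ x ∈ Icc a b, x ≤ a + n * δ → ∃ Φ, IsPrimitiveAlong ω α Φ (Icc a x) := by
    intro n
    induction n with
    | zero =>
      intro x hx hx'
      refine hloc a ⟨le_rfl, hab⟩ x hx ?_
      simp at hx'
      linarith
    | succ n ih =>
      intro x hx hx'
      rcases le_total x (a + n * δ) with h | h
      · exact ih x hx h
      · have hc : a + n * δ ∈ Icc a b :=
          ⟨le_add_of_nonneg_right (by positivity), h.trans hx.2⟩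
        obtain ⟨Φ, hΦ⟩ := ih _ hc le_rfl
        push_cast at hx'
        obtain ⟨Ψ, hΨ⟩ := hloc _ hc x hx (by linarith)
        exact ⟨_, hΦ.glue hc.1 h (hα.mono (Icc_subset_Icc_right hx.2)) hΨ⟩
  obtain ⟨n, hn⟩ := exists_nat_ge ((b - a) / δ)
  refine hind n b ⟨hab, le_rfl⟩ ?_
  rw [div_le_iff₀ hδ] at hn
  linarith

/-- The integral of a closed form over the boundary of a continuous image of a rectangle is
zero. -/
theorem IsPrimitiveAlong.rectangle {ω : ℂ → ℂ} {X : Set ℂ} (hX : IsOpen X)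
    (hω : DifferentiableOn ℂ ω X) {H : ℝ × ℝ → ℂ} {s₀ s₁ a b : ℝ} (hs : s₀ ≤ s₁) (hab : a ≤ b)
    (hH : ContinuousOn H (Icc s₀ s₁ ×ˢ Icc a b)) (hHX : MapsTo H (Icc s₀ s₁ ×ˢ Icc a b) X)
    {Φ₀ Φ₁ Ψa Ψb : ℝ → ℂ}
    (h₀ : IsPrimitiveAlong ω (fun t => H (s₀, t)) Φ₀ (Icc a b))
    (h₁ : IsPrimitiveAlong ω (fun t => H (s₁, t)) Φ₁ (Icc a b))
    (ha : IsPrimitiveAlong ω (fun s => H (s, a)) Ψa (Icc s₀ s₁))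
    (hb : IsPrimitiveAlong ω (fun s => H (s, b)) Ψb (Icc s₀ s₁)) :
    (Φ₁ b - Φ₁ a) - (Φ₀ b - Φ₀ a) = (Ψb s₁ - Ψb s₀) - (Ψa s₁ - Ψa s₀) := by
  have hcomp : IsCompact (Icc s₀ s₁ ×ˢ Icc a b) := isCompact_Icc.prod isCompact_Icc
  obtain ⟨ε, hε, hball⟩ := exists_pos_ball_subset hX (hcomp.image_of_continuousOn hH)
    hHX.image_subset
  obtain ⟨δ, hδ, hunif⟩ := Metric.uniformContinuousOn_iff.1
    (hcomp.uniformContinuousOn_of_continuous hH) ε hε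
  have hex : ∀ z, ∃ G : ℂ → ℂ, z ∈ H '' (Icc s₀ s₁ ×ˢ Icc a b) →
      ∀ w ∈ Metric.ball z ε, HasDerivAt G (ω w) w := by
    intro z
    by_cases hz : z ∈ H '' (Icc s₀ s₁ ×ˢ Icc a b)
    · obtain ⟨G, hG⟩ := (hω.mono (hball z hz)).isExactOn_ball
      exact ⟨G, fun _ => hG⟩
    · exact ⟨0, fun h => absurd h hz⟩
  choose G hG using hex
  have hrow : ∀ s ∈ Icc s₀ s₁, ContinuousOn (fun t => H (s, t)) (Icc a b) := fun s hs =>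
    hH.comp (by fun_prop) fun t ht => ⟨hs, ht⟩
  have hcol : ∀ t ∈ Icc a b, ContinuousOn (fun s => H (s, t)) (Icc s₀ s₁) := fun t ht =>
    hH.comp (by fun_prop) fun s hs => ⟨hs, ht⟩
  have hexΦ : ∀ s, ∃ Φ, s ∈ Icc s₀ s₁ → IsPrimitiveAlong ω (fun t => H (s, t)) Φ (Icc a b) := by
    intro s
    by_cases hs : s ∈ Icc s₀ s₁
    · obtain ⟨Φ, hΦ⟩ := exists_isPrimitiveAlong hX hω hab (hrow s hs) fun t ht => hHX ⟨hs, ht⟩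
      exact ⟨Φ, fun _ => hΦ⟩
    · exact ⟨0, fun h => absurd h hs⟩
  choose Φ hΦ using hexΦ
  have haI : a ∈ Icc a b := ⟨le_rfl, hab⟩
  have hbI : b ∈ Icc a b := ⟨hab, le_rfl⟩
  -- The boundary defect of the rectangle cut off at `s` is locally constant in `s`: neighbouring
  -- rows are uniformly `ε`-close, so their increments differ only by the increments along the two
  -- short sides.
  have key : ∀ s ∈ Icc s₀ s₁, ∀ᶠ u in 𝓝[Icc s₀ s₁] s,
      (Φ u b - Φ u a) - (Ψb u - Ψa u) = (Φ s b - Φ s a) - (Ψb s - Ψa s) := by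
    intro s hs
    have hGs : ∀ t ∈ Icc a b, ∀ᶠ w in 𝓝 (H (s, t)), HasDerivAt (G (H (s, t))) (ω w) w :=
      fun t ht => by
        filter_upwards [Metric.ball_mem_nhds (H (s, t)) hε] using
          hG _ (mem_image_of_mem H (mk_mem_prod hs ht))
    filter_upwards [ha.eventually_sub_eq (hcol a haI) hs (hGs a haI),
      hb.eventually_sub_eq (hcol b hbI) hs (hGs b hbI), self_mem_nhdsWithin,
      nhdsWithin_le_nhds (Metric.ball_mem_nhds s hδ)] with u h₁ h₂ hu hus
    have hclose : ∀ t ∈ Icc a b, H (u, t) ∈ Metric.ball (H (s, t)) ε := by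
      intro t ht
      refine hunif (u, t) ⟨hu, ht⟩ (s, t) ⟨hs, ht⟩ ?_
      rw [Prod.dist_eq, dist_self, max_eq_left dist_nonneg]
      exact hus
    have := IsPrimitiveAlong.sub_eq_of_close isPreconnected_Icc (hrow s hs) (hrow u hu) (hΦ s hs)
      (hΦ u hu) hε (G := G) (fun t ht => hG _ (mem_image_of_mem H (mk_mem_prod hs ht))) hclose
      hbI haI
    linear_combination this - h₂ + h₁
  have hfin := eq_of_locally_const (f := fun s => (Φ s b - Φ s a) - (Ψb s - Ψa s))
    isPreconnected_Icc key (s := s₁) (t := s₀) ⟨hs, le_rfl⟩ ⟨le_rfl, hs⟩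
  have e₀ := IsPrimitiveAlong.sub_eq_sub isPreconnected_Icc (hrow s₀ ⟨le_rfl, hs⟩) h₀
    (hΦ s₀ ⟨le_rfl, hs⟩) haI hbI
  have e₁ := IsPrimitiveAlong.sub_eq_sub isPreconnected_Icc (hrow s₁ ⟨hs, le_rfl⟩) h₁
    (hΦ s₁ ⟨hs, le_rfl⟩) haI hbI
  linear_combination hfin - e₁ + e₀

lemma IsPrimitiveAlong.hasDerivAt {ω : ℂ → ℂ} {α : ℝ → ℂ} {Φ : ℝ → ℂ} {J : Set ℝ}
    (h : IsPrimitiveAlong ω α Φ J) {t : ℝ} (ht : J ∈ 𝓝 t) {v : ℂ} (hα : HasDerivAt α v t) :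
    HasDerivAt Φ (ω (α t) * v) t := by
  obtain ⟨G, hG, hΦ⟩ := h t (mem_of_mem_nhds ht)
  rw [nhdsWithin_eq_nhds.2 ht] at hΦ
  exact (hG.self_of_nhds.comp_of_eq t hα rfl).congr_of_eventuallyEq hΦ

lemma IsPrimitiveAlong.continuousOn {ω : ℂ → ℂ} {α : ℝ → ℂ} {Φ : ℝ → ℂ} {J : Set ℝ}
    (h : IsPrimitiveAlong ω α Φ J) (hα : ContinuousOn α J) : ContinuousOn Φ J := by
  intro t ht
  obtain ⟨G, hG, hΦ⟩ := h t ht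
  have hc : ContinuousAt G (α t) := hG.self_of_nhds.continuousAt
  exact (hc.comp_continuousWithinAt (hα t ht)).congr_of_eventuallyEq hΦ
    (hΦ.self_of_nhdsWithin ht)

lemma IsPrimitiveAlong.integral_eq {ω : ℂ → ℂ} {α α' : ℝ → ℂ} {Φ : ℝ → ℂ} {a b : ℝ}
    (hab : a ≤ b) (h : IsPrimitiveAlong ω α Φ (Icc a b)) (hα : ContinuousOn α (Icc a b))
    {S : Set ℝ} (hS : S.Finite) (hd : ∀ t ∈ Ioo a b \ S, HasDerivAt α (α' t) t)
    (hint : IntervalIntegrable (fun t => ω (α t) * α' t) MeasureTheory.volume a b) :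
    ∫ t in a..b, ω (α t) * α' t = Φ b - Φ a :=
  MeasureTheory.integral_eq_of_hasDerivAt_off_countable_of_le _ _ hab hS.countable
    (h.continuousOn hα) (fun t ht => h.hasDerivAt (Icc_mem_nhds ht.1.1 ht.1.2) (hd t ht)) hint

/-! ### Line integrals of `P g₆` and reduction of iterated integrals to them. -/

section lineInt

/-- The integral of `P g₆` along the part of `p` between the parameters `a` and `b`. -/
def lineInt (P : Polynomial ℂ) (p : ℝ → ℍ) (a b : ℝ) : ℂ :=
  ∫ t in a..b, form P (p t) * velocity p t

variable {p : ℝ → ℍ} {J : Set ℝ} {a b : ℝ}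

lemma PiecewiseC1On.continuousOn_coe (hp : PiecewiseC1On p J) :
    ContinuousOn (fun t => (p t : ℂ)) J :=
  UpperHalfPlane.continuous_coe.comp_continuousOn hp.1

lemma PiecewiseC1On.exists_hasDerivAt (hp : PiecewiseC1On p J) (hab : Icc a b ⊆ J) :
    ∃ S : Set ℝ, S.Finite ∧
      ∀ t ∈ Ioo a b \ S, HasDerivAt (fun t => (p t : ℂ)) (velocity p t) t := by
  obtain ⟨S, hS, h⟩ := hp.2.1
  refine ⟨S, hS, fun t ht => ?_⟩
  have hJ : t ∈ interior J :=
    mem_interior_iff_mem_nhds.2 (mem_of_superset (Icc_mem_nhds ht.1.1 ht.1.2) hab)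
  exact ((h t ⟨hJ, ht.2⟩).differentiableAt one_ne_zero).hasDerivAt

lemma PiecewiseC1On.intervalIntegrable (hp : PiecewiseC1On p J) (hab : a ≤ b)
    (hJ : Icc a b ⊆ J) {f : ℝ → ℂ} (hf : ContinuousOn f (Icc a b)) :
    IntervalIntegrable (fun t => f t * velocity p t) MeasureTheory.volume a b := by
  obtain ⟨M, hM⟩ := hp.2.2 _ hJ isCompact_Icc
  have hv : IntervalIntegrable (velocity p) MeasureTheory.volume a b := by
    rw [intervalIntegrable_iff_integrableOn_Icc_of_le hab]
    refine MeasureTheory.Measure.integrableOn_of_bounded (M := M) (by simp)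
      (measurable_deriv _).aestronglyMeasurable ?_
    exact (MeasureTheory.ae_restrict_iff' measurableSet_Icc).2 (Eventually.of_forall hM)
  refine hv.continuousOn_mul ?_
  rwa [uIcc_of_le hab]

lemma mapsTo_regularSet (hav : ∀ t ∈ J, p t ∉ poles) :
    MapsTo (fun t => (p t : ℂ)) J regularSet :=
  fun t ht => coe_mem_regularSet.2 (hav t ht)

lemma PiecewiseC1On.continuousOn_form (hp : PiecewiseC1On p J) (hav : ∀ t ∈ J, p t ∉ poles)
    (P : Polynomial ℂ) : ContinuousOn (fun t => form P (p t)) J :=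
  (differentiableOn_form P).continuousOn.comp hp.continuousOn_coe (mapsTo_regularSet hav)

lemma PiecewiseC1On.lineInt_eq (hp : PiecewiseC1On p J) (hav : ∀ t ∈ J, p t ∉ poles)
    (hab : a ≤ b) (hJ : Icc a b ⊆ J) {P : Polynomial ℂ} {Φ : ℝ → ℂ}
    (hΦ : IsPrimitiveAlong (form P) (fun t => (p t : ℂ)) Φ (Icc a b)) :
    lineInt P p a b = Φ b - Φ a := by
  obtain ⟨S, hS, hd⟩ := hp.exists_hasDerivAt hJ
  exact hΦ.integral_eq hab (hp.continuousOn_coe.mono hJ) hS hd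
    (hp.intervalIntegrable hab hJ ((hp.continuousOn_form hav P).mono hJ))

lemma PiecewiseC1On.exists_primitive (hp : PiecewiseC1On p J) (hav : ∀ t ∈ J, p t ∉ poles)
    (hab : a ≤ b) (hJ : Icc a b ⊆ J) (P : Polynomial ℂ) :
    ∃ Φ, IsPrimitiveAlong (form P) (fun t => (p t : ℂ)) Φ (Icc a b) :=
  exists_isPrimitiveAlong isOpen_regularSet (differentiableOn_form P) hab
    (hp.continuousOn_coe.mono hJ) ((mapsTo_regularSet hav).mono_left hJ)

lemma PiecewiseC1On.lineInt_add (hp : PiecewiseC1On p J) (hav : ∀ t ∈ J, p t ∉ poles)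
    (hab : a ≤ b) (hJ : Icc a b ⊆ J) (P Q : Polynomial ℂ) :
    lineInt (P + Q) p a b = lineInt P p a b + lineInt Q p a b := by
  unfold lineInt
  rw [← intervalIntegral.integral_add
    (hp.intervalIntegrable hab hJ ((hp.continuousOn_form hav P).mono hJ))
    (hp.intervalIntegrable hab hJ ((hp.continuousOn_form hav Q).mono hJ))]
  congr 1
  ext t
  simp only [form, Polynomial.eval_add]
  ring

lemma lineInt_C_mul (x : ℂ) (P : Polynomial ℂ) (p : ℝ → ℍ) (a b : ℝ) :
    lineInt (Polynomial.C x * P) p a b = x * lineInt P p a b := by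
  unfold lineInt
  rw [← intervalIntegral.integral_const_mul]
  congr 1
  ext t
  simp only [form, Polynomial.eval_mul, Polynomial.eval_C]
  ring

lemma PiecewiseC1On.lineInt_sum (hp : PiecewiseC1On p J) (hav : ∀ t ∈ J, p t ∉ poles)
    (hab : a ≤ b) (hJ : Icc a b ⊆ J) {ι : Type} (s : Finset ι) (P : ι → Polynomial ℂ) :
    lineInt (∑ i ∈ s, P i) p a b = ∑ i ∈ s, lineInt (P i) p a b := by
  classical
  induction s using Finset.induction_on with
  | empty => simp [lineInt, form]
  | insert i s hi ih => rw [Finset.sum_insert hi, Finset.sum_insert hi,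
      hp.lineInt_add hav hab hJ, ih]

lemma PiecewiseC1On.lineInt_add_adjacent (hp : PiecewiseC1On p J) (hav : ∀ t ∈ J, p t ∉ poles)
    {c : ℝ} (hac : a ≤ c) (hcb : c ≤ b) (hJ : Icc a b ⊆ J) (P : Polynomial ℂ) :
    lineInt P p a c + lineInt P p c b = lineInt P p a b := by
  have h₁ : Icc a c ⊆ J := (Icc_subset_Icc_right hcb).trans hJ
  have h₂ : Icc c b ⊆ J := (Icc_subset_Icc_left hac).trans hJ
  exact intervalIntegral.integral_add_adjacent_intervals
    (hp.intervalIntegrable hac h₁ ((hp.continuousOn_form hav P).mono h₁))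
    (hp.intervalIntegrable hcb h₂ ((hp.continuousOn_form hav P).mono h₂))

/-- The kernel `(2πi)^(n+1) (x - s)ⁿ / n!` of the `n + 1`-fold iterated integral. -/
def kernelPoly (n : ℕ) (x : ℂ) : Polynomial ℂ :=
  Polynomial.C ((2 * Real.pi * Complex.I) ^ (n + 1) / n.factorial) *
    (Polynomial.C x - Polynomial.X) ^ n

/-- Formally the sum is `∫ (α(t) - z)^(n+1) f dz` expanded in moments. The contribution of the
moving upper limit is `(α - α)^(n+1) = 0`, so only the derivative of the kernel survives. -/
lemma sum_moment_hasDerivAt {f v : ℂ} {α : ℝ → ℂ} {M : ℕ → ℝ → ℂ} {t : ℝ} (n : ℕ)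
    (hα : HasDerivAt α v t) (hM : ∀ k, HasDerivAt (M k) ((-α t) ^ k * f * v) t) :
    HasDerivAt (fun t => ∑ m ∈ Finset.range (n + 2), α t ^ m * M (n + 1 - m) t * (n + 1).choose m)
      ((n + 1) * (v * ∑ m ∈ Finset.range (n + 1), α t ^ m * M (n - m) t * n.choose m)) t := by
  have h : HasDerivAt
      (fun t => ∑ m ∈ Finset.range (n + 2), α t ^ m * M (n + 1 - m) t * (n + 1).choose m)
      (∑ m ∈ Finset.range (n + 2), ((m * α t ^ (m - 1) * v) * M (n + 1 - m) t +
        α t ^ m * ((-α t) ^ (n + 1 - m) * f * v)) * (n + 1).choose m) t := by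
    refine HasDerivAt.fun_sum fun m _ => ?_
    exact ((hα.fun_pow m).mul (hM (n + 1 - m))).mul_const _
  refine h.congr_deriv ?_
  simp only [add_mul (_ * M _ t), Finset.sum_add_distrib]
  have h2 : ∑ m ∈ Finset.range (n + 2),
      α t ^ m * ((-α t) ^ (n + 1 - m) * f * v) * (n + 1).choose m = 0 := by
    have := add_pow (α t) (-α t) (n + 1)
    rw [add_neg_cancel, zero_pow (Nat.succ_ne_zero n)] at this
    calc _ = (∑ m ∈ Finset.range (n + 1 + 1),
        α t ^ m * (-α t) ^ (n + 1 - m) * (n + 1).choose m) * (f * v) := by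
          rw [Finset.sum_mul]
          exact Finset.sum_congr rfl fun m _ => by ring
      _ = 0 := by rw [← this, zero_mul]
  rw [h2, add_zero, Finset.sum_range_succ']
  simp only [Nat.cast_zero, zero_mul, add_zero, Finset.mul_sum]
  refine Finset.sum_congr rfl fun m _ => ?_
  have h3 : ((n : ℂ) + 1) * (n.choose m : ℂ) = ((n + 1).choose (m + 1) : ℂ) * (m + 1) := by
    exact_mod_cast Nat.add_one_mul_choose_eq n m
  rw [Nat.add_sub_cancel, Nat.add_sub_add_right]
  push_cast
  linear_combination (-(v * α t ^ m * M (n - m) t)) * h3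

/-- Cauchy's formula for repeated integration. The binomial expansion separates the moving endpoint
`p t` from the moments of `g₆`, so each step of the induction is the fundamental theorem of
calculus. -/
lemma PiecewiseC1On.iterInt_word (hp : PiecewiseC1On p J) (hav : ∀ t ∈ J, p t ∉ poles)
    (hab : a ≤ b) (hJ : Icc a b ⊆ J) (n : ℕ) :
    iterInt p a (word n) b = lineInt (kernelPoly n (p b)) p a b := by
  choose Φ hΦ using fun k : ℕ => hp.exists_primitive hav hab hJ ((-Polynomial.X) ^ k)
  have hα := hp.continuousOn_coe.mono hJ
  have hM : ∀ k, ∀ t ∈ Icc a b, lineInt ((-Polynomial.X) ^ k) p a t = Φ k t - Φ k a :=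
    fun k t ht => hp.lineInt_eq hav ht.1 ((Icc_subset_Icc_right ht.2).trans hJ)
      ((hΦ k).mono (Icc_subset_Icc_right ht.2))
  obtain ⟨S, hS, hd⟩ := hp.exists_hasDerivAt hJ
  set w : ℂ := 2 * Real.pi * Complex.I with hw
  set F : ℕ → ℝ → ℂ := fun n t =>
    ∑ m ∈ Finset.range (n + 1), (p t : ℂ) ^ m * (Φ (n - m) t - Φ (n - m) a) * n.choose m with hF
  have hFc : ∀ n, ContinuousOn (F n) (Icc a b) := fun n =>
    continuousOn_finsetSum _ fun m _ => ((hα.pow m).mul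
      (((hΦ (n - m)).continuousOn hα).sub continuousOn_const)).mul continuousOn_const
  have key : ∀ n, ∀ t ∈ Icc a b, iterInt p a (word n) t = w ^ (n + 1) / n.factorial * F n t := by
    intro n
    induction n with
    | zero =>
      intro t ht
      have h0 := hM 0 t ht
      simp only [hF, zero_add, Finset.sum_range_one, pow_zero, one_mul, Nat.choose_self,
        Nat.cast_one, mul_one, pow_one, Nat.factorial_zero, div_one, Nat.sub_zero]
      rw [← h0]
      simp only [word, List.replicate_zero, List.nil_append, iterInt, lineInt, form, g6C_coe,
        pow_zero, Polynomial.eval_one, one_mul, mul_one, hw]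
    | succ n ih =>
      intro t ht
      have hsub : Icc a t ⊆ Icc a b := Icc_subset_Icc_right ht.2
      have h1 : iterInt p a (word (n + 1)) t =
          w * ∫ s in a..t, 1 * velocity p s * iterInt p a (word n) s := rfl
      have h2 : ∫ s in a..t, 1 * velocity p s * iterInt p a (word n) s =
          ∫ s in a..t, w ^ (n + 1) / n.factorial * F n s * velocity p s := by
        refine intervalIntegral.integral_congr fun s hs => ?_
        rw [uIcc_of_le ht.1] at hs
        simp only [ih s (hsub hs)]
        ring
      have h3 : ∫ s in a..t, w ^ (n + 1) / n.factorial * F n s * velocity p s =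
          w ^ (n + 1) / (n + 1).factorial * F (n + 1) t -
            w ^ (n + 1) / (n + 1).factorial * F (n + 1) a := by
        refine MeasureTheory.integral_eq_of_hasDerivAt_off_countable_of_le
          (fun s => w ^ (n + 1) / (n + 1).factorial * F (n + 1) s) _ ht.1 hS.countable
          ((continuousOn_const.mul (hFc (n + 1))).mono hsub) (fun s hs => ?_)
          (hp.intervalIntegrable ht.1 (hsub.trans hJ)
            ((continuousOn_const.mul (hFc n)).mono hsub))
        have hs' : s ∈ Ioo a b := ⟨hs.1.1, hs.1.2.trans_le ht.2⟩
        have hds := hd s ⟨hs', hs.2⟩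
        have := sum_moment_hasDerivAt (f := g6C (p s)) n hds
          (M := fun k t => Φ k t - Φ k a) fun k => by
            refine (((hΦ k).hasDerivAt (Icc_mem_nhds hs'.1 hs'.2) hds).sub_const _).congr_deriv ?_
            simp [form]
        refine (this.const_mul _).congr_deriv ?_
        rw [Nat.factorial_succ]
        have : (n.factorial : ℂ) ≠ 0 := Nat.cast_ne_zero.2 n.factorial_ne_zero
        have : (n : ℂ) + 1 ≠ 0 := Nat.cast_add_one_ne_zero n
        push_cast
        field_simp
        rfl
      have h4 : F (n + 1) a = 0 := by simp [hF]
      rw [h1, h2, h3, h4]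
      ring
  have hbI : b ∈ Icc a b := ⟨hab, le_rfl⟩
  rw [key n b hbI, kernelPoly, lineInt_C_mul, sub_eq_add_neg, add_pow]
  congr 1
  rw [hp.lineInt_sum hav hab hJ]
  refine Finset.sum_congr rfl fun m _ => ?_
  rw [← hM _ b hbI, show (Polynomial.C (p b : ℂ) ^ m * (-Polynomial.X) ^ (n - m) *
    (n.choose m : Polynomial ℂ)) = Polynomial.C ((p b : ℂ) ^ m * n.choose m) *
      (-Polynomial.X) ^ (n - m) by simp only [map_mul, map_pow, map_natCast]; ring,
    lineInt_C_mul]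
  ring

end lineInt

/-! ### Pulling back the forms `P g₆ dz` by `γ`. -/

/-- The Möbius transformation of `γ`, as a function on the complex plane. -/
def mobius (γ : SL(2, ℤ)) (z : ℂ) : ℂ :=
  ((γ 0 0 : ℂ) * z + (γ 0 1 : ℂ)) / ((γ 1 0 : ℂ) * z + (γ 1 1 : ℂ))

lemma mobius_coe (γ : SL(2, ℤ)) (τ : ℍ) : mobius γ τ = (γ • τ : ℍ) := (coe_smul_eq γ τ).symm

lemma hasDerivAt_mobius (γ : SL(2, ℤ)) (τ : ℍ) :
    HasDerivAt (mobius γ) (1 / autFactor γ τ ^ 2) τ := by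
  have hJ := autFactor_ne_zero γ τ
  have h1 := ((hasDerivAt_id (τ : ℂ)).const_mul (γ 0 0 : ℂ)).add_const (γ 0 1 : ℂ)
  have h2 := ((hasDerivAt_id (τ : ℂ)).const_mul (γ 1 0 : ℂ)).add_const (γ 1 1 : ℂ)
  refine (h1.div h2 hJ).congr_deriv ?_
  have hdet := congrArg (Int.cast : ℤ → ℂ) (det_eq γ)
  push_cast at hdet
  simp only [id]
  congr 1
  linear_combination hdet

/-- `Q` is the image of `P` under the action of `γ` in weight `-4`. -/
def IsSlash (γ : SL(2, ℤ)) (P Q : Polynomial ℂ) : Prop :=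
  ∀ τ : ℍ, Q.eval (τ : ℂ) = autFactor γ τ ^ 4 * P.eval ((γ • τ : ℍ) : ℂ)

lemma autFactor_inv_mul (γ : SL(2, ℤ)) (τ : ℍ) :
    autFactor γ (γ⁻¹ • τ) * autFactor γ⁻¹ τ = 1 := by
  rw [← autFactor_mul, mul_inv_cancel]
  simp [autFactor]

lemma IsSlash.symm {γ : SL(2, ℤ)} {P Q : Polynomial ℂ} (h : IsSlash γ P Q) : IsSlash γ⁻¹ Q P := by
  intro τ
  rw [h, smul_inv_smul, ← mul_assoc, ← mul_pow, mul_comm (autFactor γ⁻¹ τ), autFactor_inv_mul,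
    one_pow, one_mul]

section slash

variable {γ : SL(2, ℤ)} {P Q : Polynomial ℂ}

/-- `g₆` contributes `J^6` and `d(γτ) = J^(-2) dτ`, which leaves the `J^4` absorbed into `Q`. -/
lemma IsSlash.form_eq (h : IsSlash γ P Q) (hγ : γ ∈ CongruenceSubgroup.Gamma1 6) (τ : ℍ) :
    form P (γ • τ : ℍ) * (1 / autFactor γ τ ^ 2) = form Q τ := by
  have hJ := autFactor_ne_zero γ τ
  simp only [form, h τ, g6C_coe, g6_smul hγ]
  field_simp

lemma IsSlash.hasDerivAt_comp_mobius (h : IsSlash γ P Q) (hγ : γ ∈ CongruenceSubgroup.Gamma1 6)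
    {G : ℂ → ℂ} {τ : ℍ} (hG : HasDerivAt G (form P (γ • τ : ℍ)) (γ • τ : ℍ)) :
    HasDerivAt (fun z => G (mobius γ z)) (form Q τ) τ := by
  rw [← h.form_eq hγ]
  exact hG.comp_of_eq _ (hasDerivAt_mobius γ τ) (mobius_coe γ τ).symm

/-- Local primitives are composed with the Möbius map, so the curve need not be differentiable. -/
lemma IsSlash.isPrimitiveAlong (h : IsSlash γ P Q) (hγ : γ ∈ CongruenceSubgroup.Gamma1 6)
    {p : ℝ → ℍ} {Φ : ℝ → ℂ} {J : Set ℝ}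
    (hΦ : IsPrimitiveAlong (form P) (fun t => ((γ • p t : ℍ) : ℂ)) Φ J) :
    IsPrimitiveAlong (form Q) (fun t => (p t : ℂ)) Φ J := by
  intro t ht
  obtain ⟨G, hG, hΦ'⟩ := hΦ t ht
  refine ⟨fun z => G (mobius γ z), ?_, ?_⟩
  · have hc := (hasDerivAt_mobius γ (p t)).continuousAt
    rw [ContinuousAt, mobius_coe] at hc
    filter_upwards [hc.eventually hG,
      (isOpen_lt continuous_const Complex.continuous_im).mem_nhds (p t).im_pos] with z hz hz'
    have h1 := h.hasDerivAt_comp_mobius hγ (G := G) (τ := ⟨z, hz'⟩)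
    rw [← mobius_coe] at h1
    exact h1 hz
  · filter_upwards [hΦ'] with u hu
    rw [hu, mobius_coe]

lemma IsSlash.isPrimitiveAlong_smul (h : IsSlash γ P Q) (hγ : γ ∈ CongruenceSubgroup.Gamma1 6)
    {p : ℝ → ℍ} {Φ : ℝ → ℂ} {J : Set ℝ}
    (hΦ : IsPrimitiveAlong (form Q) (fun t => (p t : ℂ)) Φ J) :
    IsPrimitiveAlong (form P) (fun t => ((γ • p t : ℍ) : ℂ)) Φ J := by
  refine h.symm.isPrimitiveAlong (inv_mem hγ) ?_
  simpa only [inv_smul_smul] using hΦ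

/-- A primitive of `P g₆` along a curve near the cusp `γ(i∞)`. -/
lemma IsSlash.isPrimitiveAlong_horoball (h : IsSlash γ P Q)
    (hγ : γ ∈ CongruenceSubgroup.Gamma1 6) {q : ℝ → ℍ} {J : Set ℝ}
    (hq : ∀ t ∈ J, height < ((γ⁻¹ • q t : ℍ) : ℂ).im) :
    IsPrimitiveAlong (form P) (fun t => (q t : ℂ))
      (fun t => cuspPrimitive Q (γ⁻¹ • q t : ℍ)) J := by
  refine h.symm.isPrimitiveAlong (inv_mem hγ) ?_
  exact isPrimitiveAlong_comp (isOpen_lt continuous_const Complex.continuous_im)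
    (fun _ hz => hasDerivAt_cuspPrimitive Q hz) hq

end slash

lemma isPrimitiveAlong_cuspPrimitive (P : Polynomial ℂ) {q : ℝ → ℍ} {J : Set ℝ}
    (hq : ∀ t ∈ J, height < (q t : ℂ).im) :
    IsPrimitiveAlong (form P) (fun t => (q t : ℂ)) (fun t => cuspPrimitive P (q t)) J :=
  isPrimitiveAlong_comp (isOpen_lt continuous_const Complex.continuous_im)
    (fun _ hz => hasDerivAt_cuspPrimitive P hz) hq

/-- For the edge of a homotopy on which the end point stays fixed. -/
lemma isPrimitiveAlong_const (P : Polynomial ℂ) {q : ℝ → ℍ} {J : Set ℝ} {τ : ℍ} (hτ : τ ∉ poles)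
    (hq : ∀ t ∈ J, q t = τ) : IsPrimitiveAlong (form P) (fun t => (q t : ℂ)) (fun _ => 0) J := by
  obtain ⟨ε, hε, hball⟩ := Metric.isOpen_iff.1 isOpen_regularSet _ (coe_mem_regularSet.2 hτ)
  obtain ⟨G, hG0, hG⟩ :=
    ((differentiableOn_form P).mono hball).isExactOn_ball.with_val_at (τ : ℂ) 0
  intro t ht
  refine ⟨G, ?_, ?_⟩
  · simp only [hq t ht]
    filter_upwards [Metric.ball_mem_nhds _ hε] using hG
  · filter_upwards [self_mem_nhdsWithin] with u hu
    rw [hq u hu, hG0]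

lemma IsPrimitiveAlong.comp {ω : ℂ → ℂ} {α : ℝ → ℂ} {Φ : ℝ → ℂ} {J K : Set ℝ}
    (h : IsPrimitiveAlong ω α Φ J) {φ : ℝ → ℝ} (hφ : ContinuousOn φ K) (hm : MapsTo φ K J) :
    IsPrimitiveAlong ω (fun t => α (φ t)) (fun t => Φ (φ t)) K := by
  intro t ht
  obtain ⟨G, hG, hΦ⟩ := h (φ t) (hm ht)
  refine ⟨G, hG, ?_⟩
  have : Tendsto φ (𝓝[K] t) (𝓝[J] (φ t)) := (hφ t ht).tendsto_nhdsWithin hm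
  exact this.eventually hΦ

/-! ### Convergence of the integrals from `i∞` and between cusps. -/

/-- The integral of `P g₆` along a path from `i∞`. -/
def cuspLineInt (P : Polynomial ℂ) (p : ℝ → ℍ) : ℂ :=
  limUnder (𝓝[>] (0 : ℝ)) fun t₀ => lineInt P p t₀ 1

/-- The integral of `P g₆` along a path from `i∞` to another cusp. -/
def cuspCuspLineInt (P : Polynomial ℂ) (r : ℝ → ℍ) : ℂ :=
  limUnder (𝓝[>] (0 : ℝ) ×ˢ 𝓝[<] (1 : ℝ)) fun t => lineInt P r t.1 t.2

lemma PiecewiseC1On.lineInt_eq_cuspPrimitive {p : ℝ → ℍ} {J : Set ℝ} (hp : PiecewiseC1On p J)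
    (hav : ∀ t ∈ J, p t ∉ poles) {a b : ℝ} (hab : a ≤ b) (hJ : Icc a b ⊆ J)
    (h : ∀ t ∈ Icc a b, height < (p t : ℂ).im) (P : Polynomial ℂ) :
    lineInt P p a b = cuspPrimitive P (p b) - cuspPrimitive P (p a) :=
  hp.lineInt_eq hav hab hJ (isPrimitiveAlong_cuspPrimitive P h)

lemma TendsToInfty.exists_height_lt {p : ℝ → ℍ} (h : TendsToInfty p (𝓝[>] 0)) :
    ∃ c ∈ Ioo (0 : ℝ) 1, ∀ t ∈ Ioc 0 c, height < (p t : ℂ).im := by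
  obtain ⟨u, hu, hsub⟩ := mem_nhdsGT_iff_exists_Ioc_subset.1 h.eventually_height_lt
  have hu' : (0 : ℝ) < u := hu
  refine ⟨min u (1 / 2), ⟨lt_min hu' (by norm_num), (min_le_right _ _).trans_lt (by norm_num)⟩,
    fun t ht => hsub ⟨ht.1, ht.2.trans (min_le_left _ _)⟩⟩

/-- Up to the parameter `c` the path lies high enough to use the primitive that vanishes at `i∞`, so
the lower limit drops out. -/
lemma PiecewiseC1On.tendsto_lineInt {p : ℝ → ℍ} {J : Set ℝ} (hp : PiecewiseC1On p J)
    (hav : ∀ t ∈ J, p t ∉ poles) (hs : TendsToInfty p (𝓝[>] 0)) {b c : ℝ} (hc0 : 0 < c)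
    (hcb : c ≤ b) (hJ : Ioc 0 b ⊆ J) (hc : ∀ t ∈ Ioc 0 c, height < (p t : ℂ).im)
    (P : Polynomial ℂ) :
    Tendsto (fun t₀ => lineInt P p t₀ b) (𝓝[>] 0)
      (𝓝 (cuspPrimitive P (p c) + lineInt P p c b)) := by
  have h := ((hs.tendsto_cuspPrimitive P).const_sub (cuspPrimitive P (p c))).add_const
    (lineInt P p c b)
  rw [sub_zero] at h
  refine h.congr' ?_
  filter_upwards [Ioc_mem_nhdsGT hc0] with t ht
  have hsub : Icc t b ⊆ J := fun x hx => hJ ⟨ht.1.trans_le hx.1, hx.2⟩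
  rw [← hp.lineInt_add_adjacent hav ht.2 hcb hsub,
    hp.lineInt_eq_cuspPrimitive hav ht.2 ((Icc_subset_Icc_right hcb).trans hsub)
      fun x hx => hc x ⟨ht.1.trans_le hx.1, hx.2⟩]

lemma IsPathFromInfty.tendsto_lineInt {p : ℝ → ℍ} {τ : ℍ} (hp : IsPathFromInfty p τ)
    (P : Polynomial ℂ) :
    Tendsto (fun t₀ => lineInt P p t₀ 1) (𝓝[>] 0) (𝓝 (cuspLineInt P p)) := by
  obtain ⟨c, hc, h⟩ := hp.source.exists_height_lt
  exact tendsto_nhds_limUnder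
    ⟨_, hp.piecewise.tendsto_lineInt hp.avoids hp.source hc.1 hc.2.le subset_rfl h P⟩

lemma IsPathFromInfty.cuspLineInt_eq {p : ℝ → ℍ} {τ : ℍ} (hp : IsPathFromInfty p τ) {c : ℝ}
    (hc0 : 0 < c) (hc1 : c ≤ 1) (hc : ∀ t ∈ Ioc 0 c, height < (p t : ℂ).im)
    (P : Polynomial ℂ) :
    cuspLineInt P p = cuspPrimitive P (p c) + lineInt P p c 1 :=
  (hp.piecewise.tendsto_lineInt hp.avoids hp.source hc0 hc1 subset_rfl hc P).limUnder_eq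

/-- Past `d` the point `γ⁻¹ • r t` is high, so the form has the primitive `cuspPrimitive Q ∘ γ⁻¹`,
which tends to zero at the target cusp. -/
lemma IsPathToCusp.tendsto_lineInt_of_le {r : ℝ → ℍ} {γ : SL(2, ℤ)} (hr : IsPathToCusp γ r)
    (hγ : γ ∈ CongruenceSubgroup.Gamma1 6) {P Q : Polynomial ℂ} (hPQ : IsSlash γ P Q) {c d : ℝ}
    (hc0 : 0 < c) (hcd : c ≤ d) (hd1 : d < 1) (hc : ∀ t ∈ Ioc 0 c, height < (r t : ℂ).im)
    (hd : ∀ t ∈ Ico d 1, height < ((γ⁻¹ • r t : ℍ) : ℂ).im) :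
    Tendsto (fun t : ℝ × ℝ => lineInt P r t.1 t.2) (𝓝[>] 0 ×ˢ 𝓝[<] 1)
      (𝓝 (cuspPrimitive P (r c) + lineInt P r c d - cuspPrimitive Q (γ⁻¹ • r d : ℍ))) := by
  have h1 := hr.piecewise.tendsto_lineInt hr.avoids hr.source hc0 hcd
    (fun x hx => ⟨hx.1, hx.2.trans_lt hd1⟩) hc P
  have h2 := (hr.target.tendsto_cuspPrimitive Q).sub_const (cuspPrimitive Q (γ⁻¹ • r d : ℍ))
  rw [zero_sub] at h2
  rw [sub_eq_add_neg]
  refine ((h1.comp tendsto_fst).add (h2.comp tendsto_snd)).congr' ?_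
  filter_upwards [prod_mem_prod (Ioc_mem_nhdsGT hc0) (Ico_mem_nhdsLT hd1)] with t ht
  obtain ⟨ht1, ht2⟩ := ht
  have hsub : Icc t.1 t.2 ⊆ Ioo 0 1 := fun x hx => ⟨ht1.1.trans_le hx.1, hx.2.trans_lt ht2.2⟩
  rw [← hr.piecewise.lineInt_add_adjacent hr.avoids (ht1.2.trans hcd) ht2.1 hsub,
    hr.piecewise.lineInt_eq hr.avoids ht2.1
      ((Icc_subset_Icc_left (ht1.2.trans hcd)).trans hsub)
      (hPQ.isPrimitiveAlong_horoball hγ fun x hx => hd x ⟨hx.1, hx.2.trans_lt ht2.2⟩)]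
  rfl

lemma IsPathToCusp.exists_height_lt {r : ℝ → ℍ} {γ : SL(2, ℤ)} (hr : IsPathToCusp γ r) {c : ℝ}
    (hc : c < 1) : ∃ d, c ≤ d ∧ d < 1 ∧ ∀ t ∈ Ico d 1, height < ((γ⁻¹ • r t : ℍ) : ℂ).im := by
  obtain ⟨u, hu, hsub⟩ := mem_nhdsLT_iff_exists_Ico_subset.1 hr.target.eventually_height_lt
  have hu' : u < 1 := hu
  exact ⟨max c u, le_max_left _ _, max_lt hc hu',
    fun t ht => hsub ⟨(le_max_right _ _).trans ht.1, ht.2⟩⟩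

lemma IsPathToCusp.tendsto_lineInt {r : ℝ → ℍ} {γ : SL(2, ℤ)} (hr : IsPathToCusp γ r)
    (hγ : γ ∈ CongruenceSubgroup.Gamma1 6) {P Q : Polynomial ℂ} (hPQ : IsSlash γ P Q) :
    Tendsto (fun t : ℝ × ℝ => lineInt P r t.1 t.2) (𝓝[>] 0 ×ˢ 𝓝[<] 1)
      (𝓝 (cuspCuspLineInt P r)) := by
  obtain ⟨c, hc, h⟩ := hr.source.exists_height_lt
  obtain ⟨d, hcd, hd, h'⟩ := hr.exists_height_lt hc.2
  exact tendsto_nhds_limUnder ⟨_, hr.tendsto_lineInt_of_le hγ hPQ hc.1 hcd hd h h'⟩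

lemma IsPathToCusp.cuspCuspLineInt_eq {r : ℝ → ℍ} {γ : SL(2, ℤ)} (hr : IsPathToCusp γ r)
    (hγ : γ ∈ CongruenceSubgroup.Gamma1 6) {P Q : Polynomial ℂ} (hPQ : IsSlash γ P Q) {c d : ℝ}
    (hc0 : 0 < c) (hcd : c ≤ d) (hd1 : d < 1) (hc : ∀ t ∈ Ioc 0 c, height < (r t : ℂ).im)
    (hd : ∀ t ∈ Ico d 1, height < ((γ⁻¹ • r t : ℍ) : ℂ).im) :
    cuspCuspLineInt P r =
      cuspPrimitive P (r c) + lineInt P r c d - cuspPrimitive Q (γ⁻¹ • r d : ℍ) :=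
  (hr.tendsto_lineInt_of_le hγ hPQ hc0 hcd hd1 hc hd).limUnder_eq

/-- The word integrals along a path from `i∞` as single integrals. -/
lemma IsPathFromInfty.tendsto_iterInt {p : ℝ → ℍ} {τ : ℍ} (hp : IsPathFromInfty p τ) (n : ℕ) :
    Tendsto (fun t₀ => iterInt p t₀ (word n) 1) (𝓝[>] 0)
      (𝓝 (cuspLineInt (kernelPoly n τ) p)) := by
  refine (hp.tendsto_lineInt (kernelPoly n τ)).congr' ?_
  filter_upwards [Ioc_mem_nhdsGT one_pos] with t ht
  rw [hp.piecewise.iterInt_word hp.avoids ht.2 (fun x hx => ⟨ht.1.trans_le hx.1, hx.2⟩),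
    hp.target]

lemma IsPathFromInfty.cuspInt_word {p : ℝ → ℍ} {τ : ℍ} (hp : IsPathFromInfty p τ) (n : ℕ) :
    cuspInt p (word n) = cuspLineInt (kernelPoly n τ) p :=
  (hp.tendsto_iterInt n).limUnder_eq

lemma IsPathFromInfty.cuspIntConverges {p : ℝ → ℍ} {τ : ℍ} (hp : IsPathFromInfty p τ) (n : ℕ) :
    CuspIntConverges p (word n) := by
  unfold CuspIntConverges
  rw [hp.cuspInt_word]
  exact hp.tendsto_iterInt n

/-! ### Homotopy invariance, including homotopies that pass through a cusp. -/

/-- Cauchy's theorem for a homotopy in the upper half plane that avoids the poles. -/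
lemma rectangle_form {H : ℝ × ℝ → ℍ} {s₀ s₁ a b : ℝ} (hs : s₀ ≤ s₁) (hab : a ≤ b)
    (hH : ContinuousOn H (Icc s₀ s₁ ×ˢ Icc a b))
    (hav : ∀ x ∈ Icc s₀ s₁ ×ˢ Icc a b, H x ∉ poles) (P : Polynomial ℂ)
    {Φ₀ Φ₁ Ψa Ψb : ℝ → ℂ}
    (h₀ : IsPrimitiveAlong (form P) (fun t => (H (s₀, t) : ℂ)) Φ₀ (Icc a b))
    (h₁ : IsPrimitiveAlong (form P) (fun t => (H (s₁, t) : ℂ)) Φ₁ (Icc a b))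
    (ha : IsPrimitiveAlong (form P) (fun s => (H (s, a) : ℂ)) Ψa (Icc s₀ s₁))
    (hb : IsPrimitiveAlong (form P) (fun s => (H (s, b) : ℂ)) Ψb (Icc s₀ s₁)) :
    (Φ₁ b - Φ₁ a) - (Φ₀ b - Φ₀ a) = (Ψb s₁ - Ψb s₀) - (Ψa s₁ - Ψa s₀) :=
  IsPrimitiveAlong.rectangle (H := fun x => (H x : ℂ)) isOpen_regularSet
    (differentiableOn_form P) hs hab (UpperHalfPlane.continuous_coe.comp_continuousOn hH)
    (fun x hx => coe_mem_regularSet.2 (hav x hx)) h₀ h₁ ha hb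

/-- The bound `1 / 4` keeps the level `c` clear of the neighbourhood of `(1, 1 / 2)` that is cut out
of the punctured square. -/
lemma TendsToInfty.exists_height_lt_of_prod {H : ℝ × ℝ → ℍ}
    (h : TendsToInfty H (𝓟 (Icc 0 1) ×ˢ 𝓝[>] 0)) :
    ∃ c ∈ Ioo (0 : ℝ) (1 / 4), ∀ s ∈ Icc (0 : ℝ) 1, ∀ t ∈ Ioc 0 c, height < (H (s, t) : ℂ).im := by
  obtain ⟨S, hS, T, hT, hST⟩ := mem_prod_iff.1 h.eventually_height_lt
  obtain ⟨u, hu, hsub⟩ := mem_nhdsGT_iff_exists_Ioc_subset.1 hT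
  have hu' : (0 : ℝ) < u := hu
  refine ⟨min u (1 / 8), ⟨lt_min hu' (by norm_num), (min_le_right _ _).trans_lt (by norm_num)⟩,
    fun s hs t ht => ?_⟩
  have : (s, t) ∈ S ×ˢ T := ⟨hS hs, hsub ⟨ht.1, ht.2.trans (min_le_left _ _)⟩⟩
  exact hST this

/-- Homotopy invariance of integrals along paths from `i∞`, for primitives along the paths. -/
lemma homotopy_form {H : ℝ × ℝ → ℍ} {s₁ c : ℝ} (hs : 0 ≤ s₁) (hc : c ≤ 1)
    (hH : ContinuousOn H (Icc 0 s₁ ×ˢ Icc c 1)) (hav : ∀ x ∈ Icc 0 s₁ ×ˢ Icc c 1, H x ∉ poles)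
    (hheight : ∀ s ∈ Icc 0 s₁, height < (H (s, c) : ℂ).im) {τ : ℍ}
    (hτ : ∀ s ∈ Icc 0 s₁, H (s, 1) = τ) (P : Polynomial ℂ) {Φ₀ Φ₁ : ℝ → ℂ}
    (h₀ : IsPrimitiveAlong (form P) (fun t => (H (0, t) : ℂ)) Φ₀ (Icc c 1))
    (h₁ : IsPrimitiveAlong (form P) (fun t => (H (s₁, t) : ℂ)) Φ₁ (Icc c 1)) :
    cuspPrimitive P (H (s₁, c)) + (Φ₁ 1 - Φ₁ c) = cuspPrimitive P (H (0, c)) + (Φ₀ 1 - Φ₀ c) := by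
  have hτ' : τ ∉ poles := by
    rw [← hτ 0 ⟨le_rfl, hs⟩]
    exact hav _ ⟨⟨le_rfl, hs⟩, ⟨hc, le_rfl⟩⟩
  have h := rectangle_form hs hc hH hav P h₀ h₁
    (isPrimitiveAlong_cuspPrimitive P (q := fun s => H (s, c)) hheight)
    (isPrimitiveAlong_const P (q := fun s => H (s, 1)) hτ' hτ)
  linear_combination h

theorem Homotopic.cuspLineInt_eq {p₀ p₁ : ℝ → ℍ} {τ : ℍ} (h₀ : IsPathFromInfty p₀ τ)
    (h₁ : IsPathFromInfty p₁ τ) (h : Homotopic p₀ p₁) (P : Polynomial ℂ) :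
    cuspLineInt P p₀ = cuspLineInt P p₁ := by
  obtain ⟨H, hH, hav, hinf, hp₀, hp₁, hend⟩ := h
  obtain ⟨c, hc, hheight⟩ := hinf.exists_height_lt_of_prod
  have hc1 : c ≤ 1 := hc.2.le.trans (by norm_num)
  have hsub : Icc c 1 ⊆ Ioc 0 1 := fun t ht => ⟨hc.1.trans_le ht.1, ht.2⟩
  have hcI : c ∈ Ioc (0 : ℝ) 1 := ⟨hc.1, hc1⟩
  have h0I : (0 : ℝ) ∈ Icc (0 : ℝ) 1 := ⟨le_rfl, zero_le_one⟩
  have h1I : (1 : ℝ) ∈ Icc (0 : ℝ) 1 := ⟨zero_le_one, le_rfl⟩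
  obtain ⟨Φ₀, hΦ₀⟩ := h₀.piecewise.exists_primitive h₀.avoids hc1 hsub P
  obtain ⟨Φ₁, hΦ₁⟩ := h₁.piecewise.exists_primitive h₁.avoids hc1 hsub P
  have key := homotopy_form (τ := p₀ 1) zero_le_one hc1 (hH.mono (prod_mono_right hsub))
    (fun x hx => hav x ⟨hx.1, hsub hx.2⟩) (fun s hs => hheight s hs c ⟨hc.1, le_rfl⟩) hend P
    (hΦ₀.congr fun t ht => by simp only [hp₀ t (hsub ht)])
    (hΦ₁.congr fun t ht => by simp only [hp₁ t (hsub ht)])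
  rw [h₀.cuspLineInt_eq hc.1 hc1 (fun t ht => by
      rw [← hp₀ t ⟨ht.1, ht.2.trans hc1⟩]; exact hheight 0 h0I t ht),
    h₁.cuspLineInt_eq hc.1 hc1 (fun t ht => by
      rw [← hp₁ t ⟨ht.1, ht.2.trans hc1⟩]; exact hheight 1 h1I t ht),
    h₀.piecewise.lineInt_eq h₀.avoids hc1 hsub hΦ₀, h₁.piecewise.lineInt_eq h₁.avoids hc1 hsub hΦ₁,
    ← hp₀ c hcI, ← hp₁ c hcI, key]

/-- The integral along `p'` is the sum of those along `r` and along `γ ∘ p`. -/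
theorem TrivialLoop.cuspLineInt_eq {γ : SL(2, ℤ)} (hγ : γ ∈ CongruenceSubgroup.Gamma1 6)
    {P Q : Polynomial ℂ} (hPQ : IsSlash γ P Q) {r p p' : ℝ → ℍ} {τ : ℍ}
    (hr : IsPathToCusp γ r) (hp : IsPathFromInfty p τ) (hp' : IsPathFromInfty p' (γ • τ))
    (h : TrivialLoop γ r p p') :
    cuspLineInt P p' = cuspCuspLineInt P r + cuspLineInt Q p := by
  obtain ⟨H, hH, hav, hinf, hcusp, h0, h1r, h1p, hend⟩ := h
  obtain ⟨c, hc, hheight⟩ := hinf.exists_height_lt_of_prod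
  obtain ⟨δ, hδ, hball⟩ := Metric.mem_nhdsWithin_iff.1 hcusp.eventually_height_lt
  -- The square of size `η` at `(1, 1 / 2)` is mapped, apart from that point, into the horoball at
  -- `γ(i∞)`. The rest splits into three rectangles on which the homotopy is continuous.
  obtain ⟨η, hη0, hηδ, hη4⟩ : ∃ η, 0 < η ∧ η < δ ∧ η < 1 / 4 :=
    ⟨min (δ / 2) (1 / 8), lt_min (half_pos hδ) (by norm_num),
      (min_le_left _ _).trans_lt (half_lt_self hδ), (min_le_right _ _).trans_lt (by norm_num)⟩
  have hhoro : ∀ s ∈ Icc (1 - η) 1, ∀ t ∈ Icc (1 / 2 - η) (1 / 2 + η), (s, t) ≠ (1, 1 / 2) →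
      height < ((γ⁻¹ • H (s, t) : ℍ) : ℂ).im := by
    intro s hs t ht hst
    refine hball ⟨?_, ⟨⟨by linarith [hs.1], hs.2⟩, by linarith [ht.1], by linarith [ht.2]⟩, hst⟩
    rw [Metric.mem_ball, Prod.dist_eq, Real.dist_eq, Real.dist_eq]
    refine (max_le ?_ ?_).trans_lt hηδ
    · rw [abs_le]; constructor <;> linarith [hs.1, hs.2]
    · rw [abs_le]; constructor <;> linarith [ht.1, ht.2]
  have hc0 := hc.1
  have hc4 := hc.2
  have hcI : c ∈ Ioc (0 : ℝ) 1 := ⟨hc0, by linarith⟩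
  have hsub : Icc c 1 ⊆ Ioc 0 1 := fun t ht => ⟨hc0.trans_le ht.1, ht.2⟩
  have hsubr : Icc (2 * c) (2 * (1 / 2 - η)) ⊆ Ioo 0 1 := fun t ht =>
    ⟨by linarith [ht.1], by linarith [ht.2]⟩
  have hsubp : Icc (2 * (1 / 2 + η) - 1) 1 ⊆ Ioc 0 1 := fun t ht =>
    ⟨by linarith [ht.1], ht.2⟩
  -- the three pieces of the punctured square
  have hP1 : Icc 0 (1 - η) ×ˢ Icc c 1 ⊆ puncturedSquare := fun x hx =>
    ⟨⟨⟨hx.1.1, by linarith [hx.1.2]⟩, hsub hx.2⟩, fun he => by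
      have := hx.1.2
      rw [mem_singleton_iff.1 he] at this
      linarith⟩
  have hP2 : Icc (1 - η) 1 ×ˢ Icc c (1 / 2 - η) ⊆ puncturedSquare := fun x hx =>
    ⟨⟨⟨by linarith [hx.1.1], hx.1.2⟩, by linarith [hx.2.1], by linarith [hx.2.2]⟩, fun he => by
      have := hx.2.2
      rw [mem_singleton_iff.1 he] at this
      linarith⟩
  have hP3 : Icc (1 - η) 1 ×ˢ Icc (1 / 2 + η) 1 ⊆ puncturedSquare := fun x hx =>
    ⟨⟨⟨by linarith [hx.1.1], hx.1.2⟩, by linarith [hx.2.1], hx.2.2⟩, fun he => by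
      have := hx.2.1
      rw [mem_singleton_iff.1 he] at this
      linarith⟩
  -- primitives along the boundary curves
  have hrow : ContinuousOn (fun t => (H (1 - η, t) : ℂ)) (Icc c 1) :=
    UpperHalfPlane.continuous_coe.comp_continuousOn (hH.comp (by fun_prop) fun t ht =>
      hP1 ⟨⟨by linarith, le_rfl⟩, ht⟩)
  obtain ⟨Φ, hΦ⟩ := exists_isPrimitiveAlong isOpen_regularSet (differentiableOn_form P) hcI.2 hrow
    fun t ht => coe_mem_regularSet.2 (hav _ (hP1 ⟨⟨by linarith, le_rfl⟩, ht⟩))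
  obtain ⟨Φ₀, hΦ₀⟩ := hp'.piecewise.exists_primitive hp'.avoids hcI.2 hsub P
  obtain ⟨Φr, hΦr⟩ := hr.piecewise.exists_primitive hr.avoids (by linarith) hsubr P
  obtain ⟨Φp, hΦp⟩ := hp.piecewise.exists_primitive hp.avoids (by linarith) hsubp Q
  have hΦr' : IsPrimitiveAlong (form P) (fun t => (H (1, t) : ℂ)) (fun t => Φr (2 * t))
      (Icc c (1 / 2 - η)) := by
    refine (hΦr.comp (φ := fun t => 2 * t) (K := Icc c (1 / 2 - η)) (by fun_prop) fun t ht =>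
      ⟨by linarith [ht.1], by linarith [ht.2]⟩).congr fun t ht => ?_
    simp only [h1r t ⟨by linarith [ht.1], by linarith [ht.2]⟩]
  have hΦp' : IsPrimitiveAlong (form P) (fun t => (H (1, t) : ℂ)) (fun t => Φp (2 * t - 1))
      (Icc (1 / 2 + η) 1) := by
    refine ((hPQ.isPrimitiveAlong_smul hγ hΦp).comp (φ := fun t => 2 * t - 1)
      (K := Icc (1 / 2 + η) 1) (by fun_prop) fun t ht =>
      ⟨by linarith [ht.1], by linarith [ht.2]⟩).congr fun t ht => ?_
    simp only [h1p t ⟨by linarith [ht.1], ht.2⟩]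
  have hA : ∀ t ∈ Icc (1 / 2 - η) (1 / 2 + η), t ≠ 1 / 2 → IsPrimitiveAlong (form P)
      (fun s => (H (s, t) : ℂ)) (fun s => cuspPrimitive Q (γ⁻¹ • H (s, t) : ℍ))
      (Icc (1 - η) 1) := fun t ht ht' =>
    hPQ.isPrimitiveAlong_horoball hγ (q := fun s => H (s, t)) fun s hs =>
      hhoro s hs t ht fun he => ht' (congrArg Prod.snd he)
  -- Cauchy's theorem on the three pieces and near the cusp
  have e1 := homotopy_form (τ := p' 1) (by linarith) hcI.2 (hH.mono hP1)
    (fun x hx => hav x (hP1 hx))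
    (fun s hs => hheight s ⟨hs.1, by linarith [hs.2]⟩ c ⟨hc0, le_rfl⟩)
    (fun s hs => hend s ⟨hs.1, by linarith [hs.2]⟩) P
    (hΦ₀.congr fun t ht => by simp only [h0 t (hsub ht)]) hΦ
  have e2 := rectangle_form (by linarith) (by linarith) (hH.mono hP2)
    (fun x hx => hav x (hP2 hx)) P (hΦ.mono (Icc_subset_Icc_right (by linarith))) hΦr'
    (isPrimitiveAlong_cuspPrimitive P (q := fun s => H (s, c)) fun s hs =>
      hheight s ⟨by linarith [hs.1], hs.2⟩ c ⟨hc0, le_rfl⟩)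
    (hA (1 / 2 - η) ⟨le_rfl, by linarith⟩ (by linarith))
  have e3 := rectangle_form (by linarith) (by linarith) (hH.mono hP3)
    (fun x hx => hav x (hP3 hx)) P (hΦ.mono (Icc_subset_Icc_left (by linarith))) hΦp'
    (hA (1 / 2 + η) ⟨by linarith, le_rfl⟩ (by linarith))
    (isPrimitiveAlong_const P (q := fun s => H (s, 1)) (hp'.avoids 1 ⟨one_pos, le_rfl⟩)
      fun s hs => hend s ⟨by linarith [hs.1], hs.2⟩)
  have hmid : Icc (1 / 2 - η) (1 / 2 + η) ⊆ Icc c 1 :=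
    Icc_subset_Icc (by linarith) (by linarith)
  -- On the left edge of the removed square, `Φ` and the primitive of the horoball have the same
  -- increment; this replaces Cauchy's theorem for the square containing the cusp.
  have e4 := IsPrimitiveAlong.sub_eq_sub isPreconnected_Icc (hrow.mono hmid) (hΦ.mono hmid)
    (hPQ.isPrimitiveAlong_horoball hγ (q := fun t => H (1 - η, t)) fun t ht =>
      hhoro _ ⟨le_rfl, by linarith⟩ t ht fun he => by
        have := congrArg Prod.fst he
        simp only at this
        linarith)
    (s := 1 / 2 - η) (t := 1 / 2 + η) ⟨le_rfl, by linarith⟩ ⟨by linarith, le_rfl⟩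
  have hrm := h1r (1 / 2 - η) ⟨by linarith, by linarith⟩
  have hrc := h1r c ⟨hc0, by linarith⟩
  have hpm := h1p (1 / 2 + η) ⟨by linarith, by linarith⟩
  rw [hp'.cuspLineInt_eq hc0 hcI.2 (fun t ht => by
      rw [← h0 t ⟨ht.1, ht.2.trans hcI.2⟩]
      exact hheight 0 ⟨le_rfl, zero_le_one⟩ t ht) P,
    hr.cuspCuspLineInt_eq hγ hPQ (c := 2 * c) (d := 2 * (1 / 2 - η)) (by linarith) (by linarith)
      (by linarith) (fun t ht => by
        have := h1r (t / 2) ⟨by linarith [ht.1], by linarith [ht.2]⟩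
        rw [mul_div_cancel₀ t two_ne_zero] at this
        rw [← this]
        exact hheight 1 ⟨zero_le_one, le_rfl⟩ _ ⟨by linarith [ht.1], by linarith [ht.2]⟩)
      (fun t ht => by
        have := h1r (t / 2) ⟨by linarith [ht.1], by linarith [ht.2]⟩
        rw [mul_div_cancel₀ t two_ne_zero] at this
        rw [← this]
        refine hhoro 1 ⟨by linarith, le_rfl⟩ _ ⟨by linarith [ht.1], by linarith [ht.2]⟩
          fun he => ?_
        have := congrArg Prod.snd he
        simp only at this
        linarith [ht.2]),
    hp.cuspLineInt_eq (c := 2 * (1 / 2 + η) - 1) (by linarith) (by linarith) (fun t ht => by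
        have := h1p ((t + 1) / 2) ⟨by linarith [ht.1], by linarith [ht.2]⟩
        rw [mul_div_cancel₀ (t + 1) two_ne_zero, add_sub_cancel_right] at this
        rw [← inv_smul_smul γ (p t), ← this]
        refine hhoro 1 ⟨by linarith, le_rfl⟩ _ ⟨by linarith [ht.1], by linarith [ht.2]⟩
          fun he => ?_
        have := congrArg Prod.snd he
        simp only at this
        linarith [ht.1]) Q,
    hp'.piecewise.lineInt_eq hp'.avoids hcI.2 hsub hΦ₀,
    hr.piecewise.lineInt_eq hr.avoids (by linarith) hsubr hΦr,
    hp.piecewise.lineInt_eq hp.avoids (by linarith) hsubp hΦp, ← h0 c hcI]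
  simp only [hrm, hrc, hpm, inv_smul_smul] at e2 e3 e4
  have hone : (2 : ℝ) * 1 - 1 = 1 := by norm_num
  rw [hone] at e3
  -- In the sum all contributions of the interior edges cancel.
  linear_combination -e1 - e2 - e3 - e4

/-! ### Kernels, and the constants attached to a path between cusps. -/

lemma IsPathFromInfty.cuspLineInt_add {p : ℝ → ℍ} {τ : ℍ} (hp : IsPathFromInfty p τ)
    (P Q : Polynomial ℂ) : cuspLineInt (P + Q) p = cuspLineInt P p + cuspLineInt Q p := by
  refine tendsto_nhds_unique (hp.tendsto_lineInt (P + Q)) ?_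
  refine ((hp.tendsto_lineInt P).add (hp.tendsto_lineInt Q)).congr' ?_
  filter_upwards [Ioc_mem_nhdsGT one_pos] with t ht
  exact (hp.piecewise.lineInt_add hp.avoids ht.2 (fun x hx => ⟨ht.1.trans_le hx.1, hx.2⟩) P Q).symm

lemma IsPathFromInfty.cuspLineInt_C_mul {p : ℝ → ℍ} {τ : ℍ} (hp : IsPathFromInfty p τ) (x : ℂ)
    (P : Polynomial ℂ) : cuspLineInt (Polynomial.C x * P) p = x * cuspLineInt P p := by
  refine tendsto_nhds_unique (hp.tendsto_lineInt _) ?_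
  simp only [lineInt_C_mul]
  exact (hp.tendsto_lineInt P).const_mul x

lemma eval_kernelPoly (n : ℕ) (x z : ℂ) : (kernelPoly n x).eval z =
    (2 * Real.pi * Complex.I) ^ (n + 1) / n.factorial * (x - z) ^ n := by
  simp [kernelPoly]

lemma kernelPoly_zero_eq (x x' : ℂ) : kernelPoly 0 x = kernelPoly 0 x' := by
  simp [kernelPoly]

/-- The kernel is affine in its endpoint, so moving the endpoint costs a multiple of `I(g₆)`. -/
lemma kernelPoly_one_eq (x x' : ℂ) : kernelPoly 1 x' = kernelPoly 1 x +
    Polynomial.C ((x' - x) * (2 * Real.pi * Complex.I)) * kernelPoly 0 0 := by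
  simp only [kernelPoly, Nat.factorial_zero, Nat.factorial_one, Nat.cast_one, div_one, pow_zero,
    mul_one, pow_one, zero_add, map_mul, map_sub, map_pow]
  ring

/-- The factor `(cτ + d)^4` clears the denominators of a polynomial of degree at most one. -/
lemma exists_isSlash (γ : SL(2, ℤ)) (α β : ℂ) :
    ∃ Q, IsSlash γ (Polynomial.C α + Polynomial.C β * Polynomial.X) Q := by
  refine ⟨(Polynomial.C (γ 1 0 : ℂ) * Polynomial.X + Polynomial.C (γ 1 1 : ℂ)) ^ 3 *
    (Polynomial.C α * (Polynomial.C (γ 1 0 : ℂ) * Polynomial.X + Polynomial.C (γ 1 1 : ℂ)) +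
      Polynomial.C β * (Polynomial.C (γ 0 0 : ℂ) * Polynomial.X + Polynomial.C (γ 0 1 : ℂ))),
    fun τ => ?_⟩
  have hJ := autFactor_ne_zero γ τ
  rw [coe_smul_eq]
  simp only [Polynomial.eval_mul, Polynomial.eval_add, Polynomial.eval_pow, Polynomial.eval_C,
    Polynomial.eval_X]
  rw [← autFactor]
  field_simp

lemma exists_isSlash_kernelPoly_one (γ : SL(2, ℤ)) (x : ℂ) : ∃ Q, IsSlash γ (kernelPoly 1 x) Q := by
  convert exists_isSlash γ ((2 * Real.pi * Complex.I) ^ 2 * x) (-(2 * Real.pi * Complex.I) ^ 2)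
    using 3
  simp only [kernelPoly, Nat.factorial_one, Nat.cast_one, div_one, pow_one, map_mul, map_neg]
  ring

lemma exists_isSlash_kernelPoly_zero (γ : SL(2, ℤ)) (x : ℂ) :
    ∃ Q, IsSlash γ (kernelPoly 0 x) Q := by
  convert exists_isSlash γ (2 * Real.pi * Complex.I) 0 using 3
  simp [kernelPoly]

section cusp

variable {γ : SL(2, ℤ)} {r : ℝ → ℍ}

lemma IsPathToCusp.tendsto_kernelPoly_one (hr : IsPathToCusp γ r)
    (hγ : γ ∈ CongruenceSubgroup.Gamma1 6) (x : ℂ) :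
    Tendsto (fun t : ℝ × ℝ => lineInt (kernelPoly 1 x) r t.1 t.2) (𝓝[>] 0 ×ˢ 𝓝[<] 1)
      (𝓝 (cuspCuspLineInt (kernelPoly 1 x) r)) := by
  obtain ⟨Q, hQ⟩ := exists_isSlash_kernelPoly_one γ x
  exact hr.tendsto_lineInt hγ hQ

lemma IsPathToCusp.tendsto_kernelPoly_zero (hr : IsPathToCusp γ r)
    (hγ : γ ∈ CongruenceSubgroup.Gamma1 6) (x : ℂ) :
    Tendsto (fun t : ℝ × ℝ => lineInt (kernelPoly 0 x) r t.1 t.2) (𝓝[>] 0 ×ˢ 𝓝[<] 1)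
      (𝓝 (cuspCuspLineInt (kernelPoly 0 x) r)) := by
  obtain ⟨Q, hQ⟩ := exists_isSlash_kernelPoly_zero γ x
  exact hr.tendsto_lineInt hγ hQ

lemma eventually_subset_Ioo : ∀ᶠ t : ℝ × ℝ in 𝓝[>] 0 ×ˢ 𝓝[<] 1,
    t.1 ≤ t.2 ∧ Icc t.1 t.2 ⊆ Ioo 0 1 := by
  filter_upwards [prod_mem_prod (Ioc_mem_nhdsGT (show (0 : ℝ) < 1 / 2 by norm_num))
    (Ico_mem_nhdsLT (show (1 / 2 : ℝ) < 1 by norm_num))] with t ht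
  exact ⟨ht.1.2.trans ht.2.1, fun x hx => ⟨ht.1.1.trans_le hx.1, hx.2.trans_lt ht.2.2⟩⟩

lemma IsPathToCusp.eventually_lineInt_kernelPoly_one (hr : IsPathToCusp γ r) (x : ℂ)
    (x' : ℝ × ℝ → ℂ) :
    ∀ᶠ t : ℝ × ℝ in 𝓝[>] 0 ×ˢ 𝓝[<] 1, lineInt (kernelPoly 1 x) r t.1 t.2 +
      (x' t - x) * (2 * Real.pi * Complex.I) * lineInt (kernelPoly 0 0) r t.1 t.2 =
      lineInt (kernelPoly 1 (x' t)) r t.1 t.2 := by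
  filter_upwards [eventually_subset_Ioo] with t ht
  rw [kernelPoly_one_eq x (x' t), hr.piecewise.lineInt_add hr.avoids ht.1 ht.2, lineInt_C_mul]

lemma IsPathToCusp.cuspCuspLineInt_kernelPoly_one (hr : IsPathToCusp γ r)
    (hγ : γ ∈ CongruenceSubgroup.Gamma1 6) (x x' : ℂ) :
    cuspCuspLineInt (kernelPoly 1 x') r = cuspCuspLineInt (kernelPoly 1 x) r +
      (x' - x) * (2 * Real.pi * Complex.I) * cuspCuspLineInt (kernelPoly 0 0) r := by
  refine tendsto_nhds_unique (hr.tendsto_kernelPoly_one hγ x') ?_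
  exact ((hr.tendsto_kernelPoly_one hγ x).add
    ((hr.tendsto_kernelPoly_zero hγ 0).const_mul _)).congr'
    (hr.eventually_lineInt_kernelPoly_one x fun _ => x')

lemma IsPathToCusp.tendsto_iterInt_word_zero (hr : IsPathToCusp γ r)
    (hγ : γ ∈ CongruenceSubgroup.Gamma1 6) :
    Tendsto (fun t : ℝ × ℝ => iterInt r t.1 (word 0) t.2) (𝓝[>] 0 ×ˢ 𝓝[<] 1)
      (𝓝 (cuspCuspLineInt (kernelPoly 0 0) r)) := by
  refine (hr.tendsto_kernelPoly_zero hγ 0).congr' ?_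
  filter_upwards [eventually_subset_Ioo] with t ht
  rw [hr.piecewise.iterInt_word hr.avoids ht.1 ht.2, kernelPoly_zero_eq]

lemma coe_smul_eq_sub (hc : γ 1 0 ≠ 0) (τ : ℍ) : ((γ • τ : ℍ) : ℂ) =
    (γ 0 0 : ℂ) / (γ 1 0 : ℂ) - 1 / ((γ 1 0 : ℂ) * autFactor γ τ) := by
  have hJ := autFactor_ne_zero γ τ
  have hc' : ((γ 1 0 : ℤ) : ℂ) ≠ 0 := Int.cast_ne_zero.2 hc
  have hdet := congrArg (Int.cast : ℤ → ℂ) (det_eq γ)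
  push_cast at hdet
  rw [coe_smul_eq, div_sub_div _ _ hc' (mul_ne_zero hc' hJ), div_eq_div_iff hJ
    (mul_ne_zero hc' (mul_ne_zero hc' hJ))]
  simp only [autFactor]
  linear_combination (-(γ 1 0 : ℂ) * ((γ 1 0 : ℂ) * τ + (γ 1 1 : ℂ))) * hdet

/-- With `u = γ⁻¹ • r t`, one has `r t = a/c - 1/(c(cu + d))`, and the imaginary part of `c(cu + d)`
is `c² Im u → ∞`. -/
lemma IsPathToCusp.tendsto_coe (hr : IsPathToCusp γ r) (hc : γ 1 0 ≠ 0) :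
    Tendsto (fun t => (r t : ℂ)) (𝓝[<] 1) (𝓝 ((γ 0 0 : ℂ) / (γ 1 0 : ℂ))) := by
  have hc' : ((γ 1 0 : ℤ) : ℝ) ≠ 0 := Int.cast_ne_zero.2 hc
  have him := hr.target.1
  have h1 : Tendsto (fun t => (γ 1 0 : ℂ) * autFactor γ (γ⁻¹ • r t)) (𝓝[<] 1)
      (Bornology.cobounded ℂ) := by
    rw [← tendsto_norm_atTop_iff_cobounded]
    refine tendsto_atTop_mono (fun t => ?_)
      (him.const_mul_atTop (show 0 < (γ 1 0 : ℝ) ^ 2 by positivity))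
    refine le_trans ?_ ((le_abs_self _).trans (Complex.abs_im_le_norm _))
    simp only [autFactor, Complex.mul_im, Complex.add_im, Complex.intCast_re, Complex.intCast_im,
      UpperHalfPlane.coe_im, zero_mul, add_zero]
    apply le_of_eq
    ring
  have h2 := (tendsto_inv₀_cobounded.comp h1).const_sub ((γ 0 0 : ℂ) / (γ 1 0 : ℂ))
  rw [sub_zero] at h2
  refine h2.congr fun t => ?_
  conv_rhs => rw [← smul_inv_smul γ (r t), coe_smul_eq_sub hc]
  simp only [Function.comp_apply, one_div]

/-- The kernel of the truncated integral ends at the moving point `r t.2`. Replacing it by `a/c`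
costs `2πi (r t.2 - a/c) I(g₆)`, which vanishes in the limit because `I(g₆)` converges. -/
lemma IsPathToCusp.tendsto_iterInt_word_one (hr : IsPathToCusp γ r)
    (hγ : γ ∈ CongruenceSubgroup.Gamma1 6) (hc : γ 1 0 ≠ 0) :
    Tendsto (fun t : ℝ × ℝ => iterInt r t.1 (word 1) t.2) (𝓝[>] 0 ×ˢ 𝓝[<] 1)
      (𝓝 (cuspCuspLineInt (kernelPoly 1 ((γ 0 0 : ℂ) / (γ 1 0 : ℂ))) r)) := by
  have h1 := (((hr.tendsto_coe hc).comp (tendsto_snd (f := 𝓝[>] (0 : ℝ)))).sub_const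
    ((γ 0 0 : ℂ) / (γ 1 0 : ℂ))).mul_const (2 * Real.pi * Complex.I : ℂ)
  have h2 := (hr.tendsto_kernelPoly_one hγ ((γ 0 0 : ℂ) / (γ 1 0 : ℂ))).add
    (h1.mul (hr.tendsto_kernelPoly_zero hγ 0))
  rw [sub_self, zero_mul, zero_mul, add_zero] at h2
  refine h2.congr' ?_
  filter_upwards [eventually_subset_Ioo,
    hr.eventually_lineInt_kernelPoly_one ((γ 0 0 : ℂ) / (γ 1 0 : ℂ)) fun t => (r t.2 : ℂ)]
    with t ht h
  rw [hr.piecewise.iterInt_word hr.avoids ht.1 ht.2, ← h]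
  rfl

lemma IsPathToCusp.cuspCuspInt_word_zero (hr : IsPathToCusp γ r)
    (hγ : γ ∈ CongruenceSubgroup.Gamma1 6) :
    cuspCuspInt r (word 0) = cuspCuspLineInt (kernelPoly 0 0) r :=
  (hr.tendsto_iterInt_word_zero hγ).limUnder_eq

lemma IsPathToCusp.cuspCuspInt_word_one (hr : IsPathToCusp γ r)
    (hγ : γ ∈ CongruenceSubgroup.Gamma1 6) (hc : γ 1 0 ≠ 0) :
    cuspCuspInt r (word 1) = cuspCuspLineInt (kernelPoly 1 ((γ 0 0 : ℂ) / (γ 1 0 : ℂ))) r :=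
  (hr.tendsto_iterInt_word_one hγ hc).limUnder_eq

lemma IsPathToCusp.cuspCuspIntConverges (hr : IsPathToCusp γ r)
    (hγ : γ ∈ CongruenceSubgroup.Gamma1 6) (hc : γ 1 0 ≠ 0) :
    CuspCuspIntConverges r (word 0) ∧ CuspCuspIntConverges r (word 1) := by
  constructor
  · unfold CuspCuspIntConverges
    rw [hr.cuspCuspInt_word_zero hγ]
    exact hr.tendsto_iterInt_word_zero hγ
  · unfold CuspCuspIntConverges
    rw [hr.cuspCuspInt_word_one hγ hc]
    exact hr.tendsto_iterInt_word_one hγ hc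

end cusp

/-! ### The transformation law of `f_{2,b}` and its quasi-Eichler form. -/

/-- The image of the kernel of `f_{2,b}` under the action of `γ` in weight `-4`. -/
lemma isSlash_kernelPoly_one (γ : SL(2, ℤ)) (τ : ℍ) :
    IsSlash γ (kernelPoly 1 (γ • τ : ℍ))
      (Polynomial.C (autFactor γ τ ^ 2) * kernelPoly 1 τ +
        Polynomial.C (-6 * autFactor γ τ * (γ 1 0 : ℂ) / (2 * Real.pi * Complex.I)) *
          kernelPoly 2 τ +
        Polynomial.C (18 * (γ 1 0 : ℂ) ^ 2 / (2 * Real.pi * Complex.I) ^ 2) * kernelPoly 3 τ +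
        Polynomial.C (-24 * (γ 1 0 : ℂ) ^ 3 / (autFactor γ τ * (2 * Real.pi * Complex.I) ^ 3)) *
          kernelPoly 4 τ) := by
  intro u
  have hw := Complex.two_pi_I_ne_zero
  simp only [Polynomial.eval_add, Polynomial.eval_mul, Polynomial.eval_C, eval_kernelPoly,
    Nat.factorial, Nat.succ_eq_add_one]
  generalize (2 * Real.pi * Complex.I : ℂ) = w at hw
  have hJ := autFactor_ne_zero γ τ
  have hj := autFactor_ne_zero γ u
  have hdet := congrArg (Int.cast : ℤ → ℂ) (det_eq γ)
  push_cast at hdet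
  have h1 : ((γ • τ : ℍ) : ℂ) - (γ • u : ℍ) = (τ - u) / (autFactor γ τ * autFactor γ u) := by
    rw [coe_smul_eq, coe_smul_eq, div_sub_div _ _ hJ hj]
    congr 1
    simp only [autFactor]
    linear_combination ((τ : ℂ) - u) * hdet
  -- Expanding the cube of this expression gives binomials 1, 3, 3, 1; multiplied by the factorials
  -- `1!`, `2!`, `3!`, `4!` of the kernels they become 1, 6, 18, 24.
  have h2 : autFactor γ u = autFactor γ τ - (γ 1 0 : ℂ) * (τ - u) := by
    simp only [autFactor]; ring
  rw [h1]
  have h3 : autFactor γ u ^ 4 * (w ^ (1 + 1) / ((1 * 1 : ℕ) : ℂ) *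
      (((τ : ℂ) - u) / (autFactor γ τ * autFactor γ u)) ^ 1) =
      w ^ 2 * autFactor γ u ^ 3 * (τ - u) / autFactor γ τ := by
    push_cast
    field_simp
  refine Eq.trans ?_ h3.symm
  rw [h2]
  push_cast
  field_simp
  ring

/-- The transformation law of `f_{2,b}`. -/
theorem f2b_transform {γ : SL(2, ℤ)} (hγ : γ ∈ CongruenceSubgroup.Gamma1 6) {r p p' : ℝ → ℍ}
    {τ : ℍ} (hr : IsPathToCusp γ r) (hp : IsPathFromInfty p τ)
    (hp' : IsPathFromInfty p' (γ • τ)) (h : TrivialLoop γ r p p') :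
    f2b p' = autFactor γ τ ^ 2 * f2b p +
      -6 * autFactor γ τ * (γ 1 0 : ℂ) / (2 * Real.pi * Complex.I) * cuspInt p (word 2) +
      18 * (γ 1 0 : ℂ) ^ 2 / (2 * Real.pi * Complex.I) ^ 2 * cuspInt p (word 3) +
      -24 * (γ 1 0 : ℂ) ^ 3 / (autFactor γ τ * (2 * Real.pi * Complex.I) ^ 3) *
        cuspInt p (word 4) + cuspCuspLineInt (kernelPoly 1 (γ • τ : ℍ)) r := by
  rw [f2b, hp'.cuspInt_word, h.cuspLineInt_eq hγ (isSlash_kernelPoly_one γ τ) hr hp hp',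
    hp.cuspLineInt_add, hp.cuspLineInt_add, hp.cuspLineInt_add, hp.cuspLineInt_C_mul,
    hp.cuspLineInt_C_mul, hp.cuspLineInt_C_mul, hp.cuspLineInt_C_mul, f2b, hp.cuspInt_word,
    hp.cuspInt_word, hp.cuspInt_word, hp.cuspInt_word]
  ring

/-- Since `γτ = a/c - 1/(cJ)`, the integral over `r` equals `C_{1,6} - 2πi C_6 / (cJ)`. -/
theorem f2b_correction {γ : SL(2, ℤ)} (hγ : γ ∈ CongruenceSubgroup.Gamma1 6) (hc : γ 1 0 ≠ 0)
    {r p p' : ℝ → ℍ} {τ : ℍ} (hr : IsPathToCusp γ r) (hp : IsPathFromInfty p τ)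
    (hp' : IsPathFromInfty p' (γ • τ)) (h : TrivialLoop γ r p p') :
    f2b p' = autFactor γ τ ^ 2 * (f2b p + correction γ r p τ) := by
  have hJ := autFactor_ne_zero γ τ
  have hw := Complex.two_pi_I_ne_zero
  have hc' : ((γ 1 0 : ℤ) : ℂ) ≠ 0 := Int.cast_ne_zero.2 hc
  rw [f2b_transform hγ hr hp hp' h, correction, hr.cuspCuspInt_word_zero hγ,
    hr.cuspCuspInt_word_one hγ hc,
    hr.cuspCuspLineInt_kernelPoly_one hγ ((γ 0 0 : ℂ) / (γ 1 0 : ℂ)), coe_smul_eq_sub hc]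
  generalize (2 * Real.pi * Complex.I : ℂ) = w at hw
  field_simp
  ring

lemma isMultivalued_cuspInt (x : ℂ) (n : ℕ) : IsMultivalued fun p => x * cuspInt p (word n) := by
  intro τ p₀ p₁ h₀ h₁ h
  simp only [h₀.cuspInt_word, h₁.cuspInt_word, h.cuspLineInt_eq h₀ h₁]

theorem isQuasiEichler_f2b : IsQuasiEichler (CongruenceSubgroup.Gamma1 6) f2b 2 3 := by
  refine ⟨?_, fun j p => (-1) ^ j * ((j + 1).factorial * Nat.choose 3 j : ℕ) /
    (2 * Real.pi * Complex.I) ^ j * cuspInt p (word (j + 1)),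
    fun j => isMultivalued_cuspInt _ _, fun γ hγ r hr => ?_⟩
  · simpa only [one_mul] using! isMultivalued_cuspInt 1 1
  -- The kernel is based at 0 instead of `a/c`, so the case `c = 0` needs no separate treatment. The
  -- integral over `r` is `A + Bγτ = (A(cτ + d) + B(aτ + b)) / (cτ + d)`, whose numerator has degree
  -- at most `3 - 2 = 1`.
  set A := cuspCuspLineInt (kernelPoly 1 0) r
  set B := 2 * Real.pi * Complex.I * cuspCuspLineInt (kernelPoly 0 0) r with hB
  refine ⟨Polynomial.C (A * (γ 1 0 : ℂ) + B * (γ 0 0 : ℂ)) * Polynomial.X +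
    Polynomial.C (A * (γ 1 1 : ℂ) + B * (γ 0 1 : ℂ)), fun i hi => ?_,
    fun τ p p' hp hp' h => ?_⟩
  · have hi' : 1 < i := by
      norm_num at hi
      exact_mod_cast hi
    refine Polynomial.coeff_eq_zero_of_natDegree_lt
      (lt_of_le_of_lt Polynomial.natDegree_linear_le hi')
  · have hJ := autFactor_ne_zero γ τ
    have hw := Complex.two_pi_I_ne_zero
    have hend : cuspCuspLineInt (kernelPoly 1 (γ • τ : ℍ)) r =
        (A * autFactor γ τ + B * ((γ 0 0 : ℂ) * τ + (γ 0 1 : ℂ))) / autFactor γ τ := by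
      rw [hr.cuspCuspLineInt_kernelPoly_one hγ 0, coe_smul_eq, hB]
      field_simp
      ring
    rw [f2b_transform hγ hr hp hp' h, hend, show Finset.Icc 1 3 = {1, 2, 3} from rfl]
    have hP : (Polynomial.C (A * (γ 1 0 : ℂ) + B * (γ 0 0 : ℂ)) * Polynomial.X +
        Polynomial.C (A * (γ 1 1 : ℂ) + B * (γ 0 1 : ℂ))).eval (τ : ℂ) =
        A * autFactor γ τ + B * ((γ 0 0 : ℂ) * τ + (γ 0 1 : ℂ)) := by
      simp only [Polynomial.eval_add, Polynomial.eval_mul, Polynomial.eval_C, Polynomial.eval_X,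
        autFactor]
      ring
    rw [hP]
    have h3 : Nat.choose 3 1 = 3 ∧ Nat.choose 3 2 = 3 ∧ Nat.choose 3 3 = 1 := by decide
    simp only [Finset.sum_insert (show (1 : ℕ) ∉ ({2, 3} : Finset ℕ) by decide),
      Finset.sum_insert (show (2 : ℕ) ∉ ({3} : Finset ℕ) by decide), Finset.sum_singleton,
      h3.1, h3.2.1, h3.2.2, Nat.factorial, zpow_neg]
    norm_cast
    generalize hw' : (2 * Real.pi * Complex.I : ℂ) = w at hw
    push_cast at hw' ⊢
    simp only [hw']
    field_simp
    ring

/-! ### The case `c = 0`. -/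

section translation

variable {γ : SL(2, ℤ)}

/-- The diagonal `-1, -1` is excluded by `a ≡ 1` modulo 6. -/
lemma diag_eq_one (hγ : γ ∈ CongruenceSubgroup.Gamma1 6) (hc : γ 1 0 = 0) :
    γ 0 0 = 1 ∧ γ 1 1 = 1 := by
  obtain ⟨a, c, d, ha, -, hd, -⟩ := gamma1_six hγ
  have h := det_eq γ
  rw [hc, mul_zero, sub_zero] at h
  rcases Int.eq_one_or_neg_one_of_mul_eq_one h with h' | h'
  · exact ⟨h', by rw [h', one_mul] at h; exact h⟩
  · omega

lemma autFactor_eq_one (hγ : γ ∈ CongruenceSubgroup.Gamma1 6) (hc : γ 1 0 = 0) (τ : ℍ) :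
    autFactor γ τ = 1 := by
  simp [autFactor, hc, (diag_eq_one hγ hc).2]

lemma coe_smul_eq_add (hγ : γ ∈ CongruenceSubgroup.Gamma1 6) (hc : γ 1 0 = 0) (τ : ℍ) :
    ((γ • τ : ℍ) : ℂ) = τ + (γ 0 1 : ℂ) := by
  rw [coe_smul_eq, autFactor_eq_one hγ hc, (diag_eq_one hγ hc).1]
  simp

lemma velocity_smul (hγ : γ ∈ CongruenceSubgroup.Gamma1 6) (hc : γ 1 0 = 0) (p : ℝ → ℍ) (t : ℝ) :
    velocity (fun t => γ • p t) t = velocity p t := by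
  simp only [velocity, coe_smul_eq_add hγ hc, deriv_add_const]

lemma IsPathFromInfty.smul (hγ : γ ∈ CongruenceSubgroup.Gamma1 6) (hc : γ 1 0 = 0) {p : ℝ → ℍ}
    {τ : ℍ} (hp : IsPathFromInfty p τ) : IsPathFromInfty (fun t => γ • p t) (γ • τ) := by
  have him : ∀ τ : ℍ, (γ • τ).im = τ.im := fun τ => by
    rw [← UpperHalfPlane.coe_im, coe_smul_eq_add hγ hc]; simp
  have hre : ∀ τ : ℍ, (γ • τ).re = τ.re + γ 0 1 := fun τ => by
    rw [← UpperHalfPlane.coe_re, coe_smul_eq_add hγ hc]; simp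
  refine ⟨⟨?_, ?_, ?_⟩, fun t ht => ?_, ⟨?_, ?_⟩, ?_⟩
  · rw [UpperHalfPlane.isEmbedding_coe.continuousOn_iff]
    refine (hp.piecewise.continuousOn_coe.add
      (continuousOn_const (c := (γ 0 1 : ℂ)))).congr fun t _ => ?_
    exact coe_smul_eq_add hγ hc (p t)
  · obtain ⟨S, hS, h⟩ := hp.piecewise.2.1
    refine ⟨S, hS, fun t ht => ?_⟩
    simp only [coe_smul_eq_add hγ hc]
    exact (h t ht).add contDiffAt_const
  · simpa only [velocity_smul hγ hc] using hp.piecewise.2.2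
  · rw [smul_mem_poles hγ]
    exact hp.avoids t ht
  · simpa only [him] using hp.source.1
  · obtain ⟨B, hB⟩ := hp.source.2
    refine ⟨B + |(γ 0 1 : ℝ)|, hB.mono fun t ht => ?_⟩
    rw [hre]
    exact (abs_add_le _ _).trans (by gcongr)
  · rw [hp.target]

lemma cuspLineInt_smul (hγ : γ ∈ CongruenceSubgroup.Gamma1 6) (hc : γ 1 0 = 0)
    {P Q : Polynomial ℂ} (hPQ : IsSlash γ P Q) (p : ℝ → ℍ) :
    cuspLineInt P (fun t => γ • p t) = cuspLineInt Q p := by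
  simp only [cuspLineInt, lineInt, velocity_smul hγ hc, ← hPQ.form_eq hγ,
    autFactor_eq_one hγ hc, one_pow, div_one, mul_one]

/-- `γ` is a translation, under which the kernel `τ - z`, the form `g₆` and the velocity are all
invariant. -/
theorem f2b_translation (hγ : γ ∈ CongruenceSubgroup.Gamma1 6) (hc : γ 1 0 = 0) {p p' : ℝ → ℍ}
    {τ : ℍ} (hp : IsPathFromInfty p τ) (hp' : IsPathFromInfty p' (γ • τ))
    (h : Homotopic p' (fun t => γ • p t)) : f2b p' = f2b p := by
  have hPQ : IsSlash γ (kernelPoly 1 (γ • τ : ℍ)) (kernelPoly 1 τ) := by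
    intro u
    rw [eval_kernelPoly, eval_kernelPoly, autFactor_eq_one hγ hc, coe_smul_eq_add hγ hc,
      coe_smul_eq_add hγ hc]
    ring
  rw [f2b, hp'.cuspInt_word, h.cuspLineInt_eq hp' (hp.smul hγ hc), cuspLineInt_smul hγ hc hPQ,
    f2b, hp.cuspInt_word]

end translation

end Banana

end

theorem mainTheorem2 :
    -- all iterated integrals involved converge
    ((∀ (τ : ℍ) (p : ℝ → ℍ), Banana.IsPathFromInfty p τ →
        ∀ j : ℕ, Banana.CuspIntConverges p (Banana.word j)) ∧
      (∀ γ ∈ CongruenceSubgroup.Gamma1 6, ∀ r : ℝ → ℍ, Banana.IsPathToCusp γ r → γ 1 0 ≠ 0 →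
        Banana.CuspCuspIntConverges r (Banana.word 0) ∧
        Banana.CuspCuspIntConverges r (Banana.word 1))) ∧
    -- the explicit transformation laws for `c ≠ 0`
    (∀ γ ∈ CongruenceSubgroup.Gamma1 6, γ 1 0 ≠ 0 →
      ∀ r : ℝ → ℍ, Banana.IsPathToCusp γ r →
      ∀ (τ : ℍ) (p p' : ℝ → ℍ), Banana.IsPathFromInfty p τ →
        Banana.IsPathFromInfty p' (γ • τ) → Banana.TrivialLoop γ r p p' →
        Banana.autFactor γ τ ^ (-2 : ℤ) * Banana.f2b p' =
            Banana.f2b p + Banana.correction γ r p τ ∧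
        Banana.autFactor γ τ ^ (-4 : ℤ) * Banana.f4b p' =
            Banana.f4b p - 3 * Banana.f2b p * Banana.correction γ r p τ
              - 3 / 2 * Banana.correction γ r p τ ^ 2 ∧
        Banana.autFactor γ τ ^ (-6 : ℤ) * Banana.f6 p' =
            Banana.f6 p - 2 * Banana.f4b p * Banana.correction γ r p τ
              + 3 * Banana.f2b p * Banana.correction γ r p τ ^ 2
              + Banana.correction γ r p τ ^ 3) ∧
    -- for `c = 0` there is no correction
    (∀ γ ∈ CongruenceSubgroup.Gamma1 6, γ 1 0 = 0 →
      ∀ (τ : ℍ) (p p' : ℝ → ℍ), Banana.IsPathFromInfty p τ →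
        Banana.IsPathFromInfty p' (γ • τ) → Banana.Homotopic p' (fun t => γ • p t) →
        Banana.f2b p' = Banana.f2b p ∧ Banana.f4b p' = Banana.f4b p ∧
          Banana.f6 p' = Banana.f6 p) ∧
    -- the structural statement
    Banana.IsQuasiEichler (CongruenceSubgroup.Gamma1 6) Banana.f2b 2 3 := by
  refine ⟨⟨fun τ p hp j => hp.cuspIntConverges j, fun γ hγ r hr hc =>
    hr.cuspCuspIntConverges hγ hc⟩, fun γ hγ hc r hr τ p p' hp hp' h => ?_,
    fun γ hγ hc τ p p' hp hp' h => ?_, Banana.isQuasiEichler_f2b⟩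
  · have hJ := Banana.autFactor_ne_zero γ τ
    have hf := Banana.f2b_correction hγ hc hr hp hp' h
    simp only [zpow_neg]
    norm_cast
    refine ⟨?_, ?_, ?_⟩
    · rw [hf, inv_mul_cancel_left₀ (pow_ne_zero 2 hJ)]
    · rw [Banana.f4b, Banana.f4b, hp'.target, hp.target, hf, Banana.g4_smul hγ]
      field_simp
      ring
    -- The `g₄` and `f2b²` terms linear in the correction combine to `-2 f4b` because of the
    -- coefficient `3 / 2` in `f4b`.
    · rw [Banana.f6, Banana.f6, Banana.f4b, hp'.target, hp.target, hf, Banana.g4_smul hγ,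
        Banana.g6_smul hγ]
      field_simp
      ring
  · have hf := Banana.f2b_translation hγ hc hp hp' h
    have h4 := Banana.g4_smul hγ τ
    have h6 := Banana.g6_smul hγ τ
    rw [Banana.autFactor_eq_one hγ hc, one_pow, one_mul] at h4 h6
    simp only [Banana.f4b, Banana.f6, hp'.target, hp.target, hf, h4, h6, and_self]
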